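/- Let $\xi_1,\xi_2,\dots$ be i.i.d. uniform $(0,1)$ random variables, with order statistics $\xi_{n1}\le\dots\le\xi_{nn}$ of the first $n$ of them. Kernel estimator. Let $k$ be a bounded probability density on $\mathbb R$ with zero mean and finite variance whose distribution function is differentiable, and let $b=b_n>0$ satisfy $b_n\to0$ and $nb_n\to\infty$. Put $$F_{n,b}(t)=\frac1{nb}\sum_{i=1}^n\int_{-\infty}^t k\Big(\frac{x-\xi_i}{b}\Big)\,dx ,\qquad F_{n,b}^{-1}(u)=\inf\{t: F_{n,b}(t)\ge u\}.$$ Scores. Let $c_{n1},\dots,c_{nn}$ ($n\ge1$) be real constants and let $J_n(t)=c_{ni}$ for $(i-1)/n<t\le i/n$, $1\le i\le n$, $J_n(0)=c_{n1}$. Let $J$ be a measurable function on $(0,1)$. Let $g$ be a left-continuous function on $(0,1)$ that is of bounded variation on $(\theta,1-\theta)$ for every $\theta\in(0,1/2)$, let $d|g|$ be the total variation measure of $dg$ on $(0,1)$, and put $\mu_n=\int_0^1 g(t)J_n(t)\,dt$. Boundedness assumption (Assumption 3). For some $M,b_1,b_2,\delta>0$, with $$B(t)=Mt^{-b_1}(1-t)^{-b_2},\quad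 D(t)=Mt^{-1+b_1+\delta}(1-t)^{-1+b_2+\delta},\quad h(t)=[t(1-t)]^{1-\delta/2},$$ one has $|g|\le D$, $|J_n|\le B$ for all $n\ge1$, and $|J|\le B$ on $(0,1)$, and $\int_0^1 B\,h\,d|g|<\infty$. Corollary 2. If in addition $\lim_{n\to\infty}\mu_n=\mu_\infty$ exists and is finite, then with probability one $$\lim_{n\to\infty}T_n=\mu_\infty ,$$ both for the kernel statistic $T_n=\int_0^1 g(F_{n,b}^{-1}(u))\,J_n(u)\,du$, where the integral extends over those $u\in(0,1)$ with $F_{n,b}^{-1}(u)\in(0,1)$ (the domain of $g$), and for the linear combination of order statistics $T_n=\frac1n\sum_{i=1}^n c_{ni}\,g(\xi_{ni})$. -/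

import Mathlib

open MeasureTheory ProbabilityTheory Filter Topology Set

noncomputable section

namespace KernelLStat

/-! ### Kernel, bandwidth and the kernel distribution function estimator -/

/-- The kernel distribution function `K` with density `k`. -/
def kernelCDF (k : ℝ → ℝ) (x : ℝ) : ℝ := ∫ t in Iic x, k t

/-- `k` is a bounded probability density with zero mean and finite variance whose
distribution function is differentiable. -/
structure KernelAssumption (k : ℝ → ℝ) : Prop where
  nonneg : ∀ x, 0 ≤ k x
  integrable : Integrable k
  integral_eq_one : ∫ x, k x = 1
  bounded : ∃ C : ℝ, ∀ x, k x ≤ C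
  integrable_mean : Integrable fun x => x * k x
  mean_zero : ∫ x, x * k x = 0
  finite_variance : Integrable fun x => x ^ 2 * k x
  differentiable : Differentiable ℝ (kernelCDF k)

/-- The smoothing parameter is positive, with `b → 0` and `n b → ∞` as `n → ∞`. -/
structure BandwidthAssumption (b : ℕ → ℝ) : Prop where
  pos : ∀ n, 1 ≤ n → 0 < b n
  tendsto_zero : Tendsto b atTop (𝓝 0)
  tendsto_mul : Tendsto (fun n : ℕ => (n : ℝ) * b n) atTop atTop

/-- `F_{n,b}(t) = (n b)⁻¹ ∑_{i ≤ n} ∫_{-∞}^t k((x - ξ_i) / b) dx`, for the sample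
`x 0, …, x (n - 1)` and the bandwidth `b`. -/
def kernelEstimator (k : ℝ → ℝ) (b : ℝ) (n : ℕ) (x : ℕ → ℝ) (t : ℝ) : ℝ :=
  1 / ((n : ℝ) * b) * ∑ i ∈ Finset.range n, ∫ s in Iic t, k ((s - x i) / b)

/-- The left-continuous inverse `u ↦ inf {t | u ≤ F t}`. -/
def leftInverse (F : ℝ → ℝ) (u : ℝ) : ℝ := sInf {t | u ≤ F t}

/-! ### The class `𝒢` and the measure `d|g|` -/

/-- Left-continuous functions on `(0, 1)` that are of bounded variation on `(θ, 1 - θ)` for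
all `θ ∈ (0, 1/2)`. Only the values of `g` on `(0, 1)` matter. -/
structure MemG (g : ℝ → ℝ) : Prop where
  leftCont : ∀ t ∈ Ioo (0 : ℝ) 1, ContinuousWithinAt g (Iic t) t
  boundedVar : ∀ θ ∈ Ioo (0 : ℝ) (1 / 2), BoundedVariationOn g (Ioo θ (1 - θ))

/-- `g` frozen outside `[θ, 1 - θ]`. -/
def freeze (g : ℝ → ℝ) (θ : ℝ) (t : ℝ) : ℝ := g (max θ (min t (1 - θ)))

/-- The truncation level `1 / (m + 3)`, which lies in `(0, 1/2)` and decreases to `0`. -/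
def level (m : ℕ) : ℝ := 1 / ((m : ℝ) + 3)

theorem level_mem (m : ℕ) : 0 < level m ∧ level m < 1 / 2 := by
  have hm : (0 : ℝ) ≤ m := Nat.cast_nonneg m
  refine ⟨by unfold level; positivity, ?_⟩
  unfold level
  exact one_div_lt_one_div_of_lt (by norm_num) (by linarith)

theorem MemG.boundedVariationOn_freeze {g : ℝ → ℝ} (hg : MemG g) (m : ℕ) :
    BoundedVariationOn (freeze g (level m)) univ := by
  obtain ⟨h0, h1⟩ := level_mem m
  have hb := hg.boundedVar (level m / 2) ⟨by linarith, by linarith⟩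
  refine ne_top_of_le_ne_top hb ?_
  refine eVariationOn.comp_le_of_monotoneOn g (fun t => max (level m) (min t (1 - level m)))
    ?_ ?_
  · intro x _ y _ hxy
    exact max_le_max le_rfl (min_le_min hxy le_rfl)
  · intro x _
    refine ⟨lt_of_lt_of_le (by linarith) (le_max_left _ _), ?_⟩
    exact lt_of_le_of_lt (max_le (by linarith) (min_le_right _ _)) (by linarith)

/-- The measure `d|g|` on `(0, 1)`: on each `(θ, 1 - θ)` it is the total variation of the
Lebesgue–Stieltjes signed measure `dg`. -/
def variationMeasure (g : ℝ → ℝ) (hg : MemG g) : Measure ℝ :=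
  ⨆ m : ℕ, ((hg.boundedVariationOn_freeze m).vectorMeasure.variation).restrict
    (Ioo (level m) (1 - level m))

/-! ### Scores and the boundedness assumption -/

/-- The score function `J_n`: `J_n(t) = c_{ni}` for `(i - 1) / n < t ≤ i / n`, `1 ≤ i ≤ n`, and
`J_n(0) = c_{n1}`. -/
def scoreFun (c : ℕ → ℕ → ℝ) (n : ℕ) (t : ℝ) : ℝ :=
  if t ≤ 0 then c n 1 else c n ⌈(n : ℝ) * t⌉₊

/-- `B(t) = M t^{-b₁} (1 - t)^{-b₂}`. -/
def boundB (M b₁ b₂ : ℝ) (t : ℝ) : ℝ := M * t ^ (-b₁) * (1 - t) ^ (-b₂)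

/-- `D(t) = M t^{-1 + b₁ + δ} (1 - t)^{-1 + b₂ + δ}`. -/
def boundD (M b₁ b₂ δ : ℝ) (t : ℝ) : ℝ := M * t ^ (-1 + b₁ + δ) * (1 - t) ^ (-1 + b₂ + δ)

/-- `h(t) = [t (1 - t)]^{1 - δ/2}`. -/
def weightH (δ : ℝ) (t : ℝ) : ℝ := (t * (1 - t)) ^ (1 - δ / 2)

/-- `|g| ≤ D`, `|J_n| ≤ B` and `|J| ≤ B` on `(0, 1)`, and `∫₀¹ B h d|g| < ∞`. -/
structure BoundednessAssumption (g : ℝ → ℝ) (hg : MemG g) (c : ℕ → ℕ → ℝ) (J : ℝ → ℝ)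
    (M b₁ b₂ δ : ℝ) : Prop where
  g_le : ∀ t ∈ Ioo (0 : ℝ) 1, |g t| ≤ boundD M b₁ b₂ δ t
  scoreFun_le : ∀ n, 1 ≤ n → ∀ t ∈ Ioo (0 : ℝ) 1, |scoreFun c n t| ≤ boundB M b₁ b₂ t
  J_le : ∀ t ∈ Ioo (0 : ℝ) 1, |J t| ≤ boundB M b₁ b₂ t
  integral_lt_top :
    ∫⁻ t in Ioo (0 : ℝ) 1, ENNReal.ofReal (boundB M b₁ b₂ t * weightH δ t)
      ∂(variationMeasure g hg) < ⊤

/-! ### The statistics -/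

/-- `μ_n = ∫₀¹ g J_n dF` with `F` the uniform distribution function. -/
def centering (g : ℝ → ℝ) (c : ℕ → ℕ → ℝ) (n : ℕ) : ℝ :=
  ∫ t in Ioo (0 : ℝ) 1, g t * scoreFun c n t

/-- The kernel form `∫₀¹ g(F_{n,b}⁻¹) J_n dF`. As `g` lives on `(0, 1)` only, the integral
extends over those `u` for which `F_{n,b}⁻¹(u) ∈ (0, 1)`. -/
def kernelStat (k : ℝ → ℝ) (b : ℕ → ℝ) (g : ℝ → ℝ) (c : ℕ → ℕ → ℝ) (n : ℕ) (x : ℕ → ℝ) : ℝ :=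
  ∫ u in {u | u ∈ Ioo (0 : ℝ) 1 ∧
      leftInverse (kernelEstimator k (b n) n x) u ∈ Ioo (0 : ℝ) 1},
    g (leftInverse (kernelEstimator k (b n) n x) u) * scoreFun c n u

/-- The order statistics of the sample `x 0, …, x (n - 1)`; the index `i : Fin n` gives the
`(i + 1)`-st smallest value. -/
def orderStat (n : ℕ) (x : ℕ → ℝ) (i : Fin n) : ℝ :=
  ((fun j : Fin n => x j) ∘ Tuple.sort (fun j : Fin n => x j)) i

/-- The order-statistics form `n⁻¹ ∑_{i ≤ n} c_{ni} g(ξ_{ni})`. -/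
def orderStatSum (g : ℝ → ℝ) (c : ℕ → ℕ → ℝ) (n : ℕ) (x : ℕ → ℝ) : ℝ :=
  1 / (n : ℝ) * ∑ i : Fin n, g (orderStat n x i) * c n ((i : ℕ) + 1)

end KernelLStat

end

open scoped ENNReal

noncomputable section

namespace KernelLStat

/-! ### Convergence of integrals under a bound on a power -/

/-! Both statistics have the form `∫ g(Q_n) J_n` over `(0, 1)`, where `Q_n` is the quantile function
of a random distribution function `F_n`: the kernel estimator, or the empirical one, for which
`Q_n(u)` is the order statistic of rank `⌈n u⌉`. It suffices that `∫ |g(Q_n) - g| |J_n| → 0` almost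
surely, since `∫ g J_n = μ_n`.

The integrand tends to `0` almost everywhere: `Q_n(u) → u`, `g` is continuous off a null set, and
`|J_n(u)| ≤ B(u)`. The passage to the integral uses uniform integrability, through a bound in `L^p`
with `p = 1 + d` (`tendsto_lintegral_enorm_of_rpow_le`).

The obstacle is that `g` is bounded in terms of `Q_n(u)` and `J_n` in terms of `u`. Almost surely
`Q_n(u) ^ r ≤ C max(u, 1/n)` for an `r` slightly above `1`, and likewise at the right end. As `J_n`
is constant on cells of length `1/n`, this rewrites its bound in terms of `Q_n(u)`, at the cost of
part of the margin `δ`. Hence `|g(Q_n) J_n| ≤ K w(Q_n)` with `w(t) = (t (1 - t)) ^ (-(1 - d))`, and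
only `∫ w(Q_n) ^ p` has to stay bounded, where `w ^ p` has exponent `-(1 - d²)` and is integrable.
`QuantileApprox` collects what is needed of `F_n`, and `QuantileApprox.tendsto_integral` is the
deterministic argument.

The probabilistic inputs are the law of large numbers at rational points, Chernoff bounds with
Borel–Cantelli for the tails (`ae_eventually_rpow_le_strict`), and the moment bound. For the
empirical distribution the latter is again the law of large numbers; for the kernel it is a Chernoff
bound for averages of the convolved weight (`ae_eventually_smoothing_average_le`). The kernel tails
reduce to the empirical ones because `0 < K(0) < 1` for the kernel distribution function `K`. -/

theorem ennreal_le_min_add_rpow {p : ℝ} (hp : 1 < p) {L : ℝ≥0∞} (hL0 : L ≠ 0) (hL : L ≠ ∞)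
    (x : ℝ≥0∞) : x ≤ min x L + x ^ p * L ^ (1 - p) := by
  rcases le_total x L with h | h
  · rw [min_eq_left h]; exact le_self_add
  · refine le_trans ?_ le_add_self
    by_cases hx : x = ∞
    · subst hx
      rw [ENNReal.top_rpow_of_pos (by linarith), ENNReal.top_mul]
      exact (ENNReal.rpow_pos (pos_iff_ne_zero.2 hL0) hL).ne'
    have hx0 : x ≠ 0 := fun h0 => hL0 (le_antisymm (h0 ▸ h) zero_le)
    calc x = x ^ p * x ^ (1 - p) := by
          rw [← ENNReal.rpow_add _ _ hx0 hx]; simp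
      _ ≤ x ^ p * L ^ (1 - p) := by
          gcongr 1
          rw [show (1 - p) = -(p - 1) by ring, ENNReal.rpow_neg, ENNReal.rpow_neg]
          gcongr

/-- Vitali convergence in de la Vallée Poussin form. The part truncated at `L` converges by
domination, and the excess is at most `A * L ^ (1 - p)`, uniformly in `n`, which is small for large
`L`. -/
theorem tendsto_lintegral_enorm_of_rpow_le {α : Type*} [MeasurableSpace α] {μ : Measure α}
    [IsFiniteMeasure μ] {h : ℕ → α → ℝ} (hm : ∀ᶠ n in atTop, AEStronglyMeasurable (h n) μ)
    (hlim : ∀ᵐ x ∂μ, Tendsto (fun n => h n x) atTop (𝓝 0)) {p : ℝ} (hp : 1 < p) {A : ℝ≥0∞}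
    (hA : A ≠ ∞) (hb : ∀ᶠ n in atTop, ∫⁻ x, ‖h n x‖ₑ ^ p ∂μ ≤ A) :
    Tendsto (fun n => ∫⁻ x, ‖h n x‖ₑ ∂μ) atTop (𝓝 0) := by
  rw [ENNReal.tendsto_nhds_zero]
  intro ε hε
  have h1 : Tendsto (fun m : ℕ => A * ((m : ℝ≥0∞)) ^ (1 - p)) atTop (𝓝 (A * 0)) := by
    refine ENNReal.Tendsto.const_mul ?_ (Or.inr hA)
    have : Tendsto (fun m : ℕ => ((m : ℝ≥0∞) ^ (p - 1))⁻¹) atTop (𝓝 ((∞ : ℝ≥0∞) ^ (p - 1))⁻¹) :=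
      (ENNReal.tendsto_nat_nhds_top.ennrpow_const (p - 1)).inv
    rw [ENNReal.top_rpow_of_pos (by linarith), ENNReal.inv_top] at this
    refine this.congr fun m => ?_
    rw [← ENNReal.rpow_neg]; ring_nf
  rw [mul_zero, ENNReal.tendsto_nhds_zero] at h1
  obtain ⟨L, hL, hL1⟩ := ((h1 (ε / 2) (ENNReal.half_pos hε.ne')).and (eventually_ge_atTop 1)).exists
  have hL0 : (L : ℝ≥0∞) ≠ 0 := by
    simp only [ne_eq, Nat.cast_eq_zero]; omega
  have h2 : Tendsto (fun n => ∫⁻ x, min ‖h n x‖ₑ (L : ℝ≥0∞) ∂μ) atTop (𝓝 (∫⁻ _, 0 ∂μ)) := by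
    refine tendsto_lintegral_filter_of_dominated_convergence' (fun _ => (L : ℝ≥0∞)) ?_ ?_ ?_ ?_
    · filter_upwards [hm] with n hn
      exact hn.enorm.min aemeasurable_const
    · exact Eventually.of_forall fun n => Eventually.of_forall fun x => min_le_right _ _
    · rw [lintegral_const]
      exact ENNReal.mul_ne_top (ENNReal.natCast_ne_top L) (measure_ne_top _ _)
    · filter_upwards [hlim] with x hx
      have := hx.enorm.min (tendsto_const_nhds (x := (L : ℝ≥0∞)))
      simpa using this
  rw [lintegral_zero, ENNReal.tendsto_nhds_zero] at h2
  filter_upwards [h2 (ε / 2) (ENNReal.half_pos hε.ne'), hb, hm] with n h3 h4 h5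
  calc ∫⁻ x, ‖h n x‖ₑ ∂μ
      ≤ ∫⁻ x, (min ‖h n x‖ₑ (L : ℝ≥0∞) + ‖h n x‖ₑ ^ p * (L : ℝ≥0∞) ^ (1 - p)) ∂μ :=
        lintegral_mono fun x => ennreal_le_min_add_rpow hp hL0 (ENNReal.natCast_ne_top L) _
    _ = (∫⁻ x, min ‖h n x‖ₑ (L : ℝ≥0∞) ∂μ) + (∫⁻ x, ‖h n x‖ₑ ^ p ∂μ) * (L : ℝ≥0∞) ^ (1 - p) := by
        rw [lintegral_add_left' (h5.enorm.min aemeasurable_const),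
          lintegral_mul_const'' _ (h5.enorm.pow_const p)]
    _ ≤ ε / 2 + A * (L : ℝ≥0∞) ^ (1 - p) := by gcongr
    _ ≤ ε / 2 + ε / 2 := by gcongr
    _ = ε := ENNReal.add_halves ε

theorem integrable_of_lintegral_rpow_lt_top {α : Type*} [MeasurableSpace α] {μ : Measure α}
    [IsFiniteMeasure μ] {f : α → ℝ} (hm : AEStronglyMeasurable f μ) {p : ℝ} (hp : 1 < p)
    (hb : ∫⁻ x, ‖f x‖ₑ ^ p ∂μ < ∞) : Integrable f μ := by
  refine ⟨hm, ?_⟩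
  calc ∫⁻ x, ‖f x‖ₑ ∂μ ≤ ∫⁻ x, (1 + ‖f x‖ₑ ^ p) ∂μ := by
        refine lintegral_mono fun x => ?_
        refine (ennreal_le_min_add_rpow hp one_ne_zero ENNReal.one_ne_top _).trans ?_
        simp only [ENNReal.one_rpow, mul_one]
        gcongr
        exact min_le_right _ _
    _ < ∞ := by
        rw [lintegral_add_left measurable_const]
        refine ENNReal.add_lt_top.2 ⟨?_, hb⟩
        simp

/-! ### Regularity of functions in the class `𝒢` -/

theorem level_tendsto : Tendsto level atTop (𝓝 0) := by
  unfold level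
  exact tendsto_const_nhds.div_atTop
    (tendsto_atTop_add_const_right _ _ tendsto_natCast_atTop_atTop)

theorem eventually_mem_Ioo_level {t : ℝ} (ht : t ∈ Ioo (0 : ℝ) 1) :
    ∀ᶠ m in atTop, t ∈ Ioo (level m) (1 - level m) := by
  have h : 0 < min t (1 - t) := lt_min ht.1 (by linarith [ht.2])
  filter_upwards [level_tendsto.eventually_lt_const h] with m hm
  exact ⟨hm.trans_le (min_le_left _ _), by linarith [hm.trans_le (min_le_right t (1 - t))]⟩

theorem freeze_eq {g : ℝ → ℝ} {θ t : ℝ} (ht : t ∈ Ioo θ (1 - θ)) : freeze g θ t = g t := by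
  unfold freeze
  rw [min_eq_left ht.2.le, max_eq_right ht.1.le]

theorem measurable_of_boundedVariationOn {f : ℝ → ℝ} (hf : BoundedVariationOn f univ) :
    Measurable f := by
  obtain ⟨p, q, hp, hq, rfl⟩ := hf.locallyBoundedVariationOn.exists_monotoneOn_sub_monotoneOn
  exact (monotoneOn_univ.1 hp).measurable.sub (monotoneOn_univ.1 hq).measurable

theorem MemG.measurable_indicator {g : ℝ → ℝ} (hg : MemG g) :
    Measurable ((Ioo (0 : ℝ) 1).indicator g) := by
  refine measurable_of_tendsto_metrizable (f := fun m =>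
    (Ioo (0 : ℝ) 1).indicator (freeze g (level m)))
    (fun m => (measurable_of_boundedVariationOn (hg.boundedVariationOn_freeze m)).indicator
      measurableSet_Ioo) ?_
  rw [tendsto_pi_nhds]
  intro t
  by_cases ht : t ∈ Ioo (0 : ℝ) 1
  · refine tendsto_const_nhds.congr' ?_
    filter_upwards [eventually_mem_Ioo_level ht] with m hm
    rw [indicator_of_mem ht, indicator_of_mem ht, freeze_eq hm]
  · simp [indicator_of_notMem ht]

/-- Functions of bounded variation are differentiable almost everywhere; there are only countably
many truncation levels, and near each point of `(0, 1)` some frozen function coincides with `g`. -/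
theorem MemG.ae_continuousAt {g : ℝ → ℝ} (hg : MemG g) :
    ∀ᵐ t, t ∈ Ioo (0 : ℝ) 1 → ContinuousAt g t := by
  have h : ∀ᵐ t, ∀ m : ℕ, DifferentiableAt ℝ (freeze g (level m)) t :=
    ae_all_iff.2 fun m =>
      (hg.boundedVariationOn_freeze m).locallyBoundedVariationOn.ae_differentiableAt
  filter_upwards [h] with t ht h01
  obtain ⟨m, hm⟩ := (eventually_mem_Ioo_level h01).exists
  refine (ht m).continuousAt.congr ?_
  filter_upwards [Ioo_mem_nhds hm.1 hm.2] with s hs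
  exact freeze_eq hs

/-! ### Bounds for the scores -/

theorem scoreFun_eq_of_ceil {c : ℕ → ℕ → ℝ} {n : ℕ} {s t : ℝ} (hs : 0 < s) (ht : 0 < t)
    (h : ⌈(n : ℝ) * s⌉₊ = ⌈(n : ℝ) * t⌉₊) : scoreFun c n s = scoreFun c n t := by
  unfold scoreFun
  rw [if_neg hs.not_ge, if_neg ht.not_ge, h]

/-- The score is constant on the cell containing `u`, so its bound may be read at the midpoint `v`
of that cell, and `v`, `1 - v` are at least half of `max u (1/n)`, `max (1 - u) (1/n)`. The bound
thus stops growing once `u` is within `1/n` of an end point. -/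
theorem abs_scoreFun_le {c : ℕ → ℕ → ℝ} {n : ℕ} (hn : 1 ≤ n) {M b₁ b₂ : ℝ} (hM : 0 < M)
    (hb₁ : 0 < b₁) (hb₂ : 0 < b₂)
    (hc : ∀ t ∈ Ioo (0 : ℝ) 1, |scoreFun c n t| ≤ boundB M b₁ b₂ t) {u : ℝ}
    (hu : u ∈ Ioo (0 : ℝ) 1) :
    |scoreFun c n u| ≤
      M * (max u (1 / n) / 2) ^ (-b₁) * (max (1 - u) (1 / n) / 2) ^ (-b₂) := by
  have hn0 : (0 : ℝ) < n := by exact_mod_cast hn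
  set i := ⌈(n : ℝ) * u⌉₊ with hi
  have hi0 : 0 < i := Nat.ceil_pos.2 (mul_pos hn0 hu.1)
  have hi1 : (1 : ℝ) ≤ i := by exact_mod_cast hi0
  have hin : i ≤ n := by
    refine Nat.ceil_le.2 ?_
    nlinarith [hu.2]
  have hin' : (i : ℝ) ≤ n := by exact_mod_cast hin
  have hle : (n : ℝ) * u ≤ i := Nat.le_ceil _
  have hlt : (i : ℝ) < n * u + 1 := Nat.ceil_lt_add_one (mul_pos hn0 hu.1).le
  set v : ℝ := (i - 1 / 2) / n with hv
  have hnv : (n : ℝ) * v = i - 1 / 2 := by rw [hv]; field_simp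
  have hv0 : 0 < v := div_pos (by linarith) hn0
  have hv1 : v < 1 := (div_lt_one hn0).2 (by linarith)
  have hceil : ⌈(n : ℝ) * v⌉₊ = i := by
    rw [hnv, Nat.ceil_eq_iff hi0.ne']
    rw [Nat.cast_sub hi0]
    constructor <;> push_cast <;> linarith
  rw [scoreFun_eq_of_ceil hu.1 hv0 (hi.symm.trans hceil.symm)]
  refine (hc v ⟨hv0, hv1⟩).trans ?_
  unfold boundB
  have hmax1 : max u (1 / n) / 2 ≤ v := by
    rw [div_le_iff₀ two_pos]
    refine max_le ?_ ?_
    · refine le_of_mul_le_mul_left ?_ hn0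
      nlinarith
    · rw [div_le_iff₀ hn0]; nlinarith
  have hmax2 : max (1 - u) (1 / n) / 2 ≤ 1 - v := by
    rw [div_le_iff₀ two_pos]
    refine max_le ?_ ?_
    · refine le_of_mul_le_mul_left ?_ hn0
      nlinarith
    · rw [div_le_iff₀ hn0]; nlinarith
  have hp1 : 0 < max u (1 / n) / 2 := half_pos (lt_max_of_lt_left hu.1)
  have hp2 : 0 < max (1 - u) (1 / n) / 2 := half_pos (lt_max_of_lt_left (by linarith [hu.2]))
  have e1 := Real.rpow_le_rpow_of_nonpos hp1 hmax1 (neg_nonpos.2 hb₁.le)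
  have e2 := Real.rpow_le_rpow_of_nonpos hp2 hmax2 (neg_nonpos.2 hb₂.le)
  gcongr

/-- The exchange of variables at one end point, used with `x = Q_n(u)` and `m = max u (1/n)`. The
resulting exponent is `-1 + δ - (r - 1) b`; half of `δ` pays for `r > 1` and the other half leaves
`-1 + d`. -/
theorem rpow_mul_half_rpow_le {x m C r b δ d : ℝ} (hx : x ∈ Ioo (0 : ℝ) 1) (hC : 0 < C)
    (hb : 0 < b) (h : x ^ r ≤ C * m) (hr : (r - 1) * b ≤ δ / 2) (hd : d ≤ δ / 2) :
    x ^ (-1 + b + δ) * (m / 2) ^ (-b) ≤ (2 * C) ^ b * x ^ (-(1 - d)) := by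
  have hx0 := hx.1
  have h1 : x ^ r / (2 * C) ≤ m / 2 := by
    rw [div_le_iff₀ (by positivity)]; linarith
  have h2 : (m / 2) ^ (-b) ≤ (x ^ r / (2 * C)) ^ (-b) :=
    Real.rpow_le_rpow_of_nonpos (by positivity) h1 (by linarith)
  have h3 : (x ^ r / (2 * C)) ^ (-b) = (2 * C) ^ b * x ^ (-(r * b)) := by
    rw [Real.div_rpow (by positivity) (by positivity), ← Real.rpow_mul hx0.le,
      Real.rpow_neg (by positivity : 0 ≤ 2 * C)]
    field_simp
  calc x ^ (-1 + b + δ) * (m / 2) ^ (-b)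
      ≤ x ^ (-1 + b + δ) * ((2 * C) ^ b * x ^ (-(r * b))) := by
        rw [← h3]; gcongr
    _ = (2 * C) ^ b * x ^ (-1 + b + δ - r * b) := by
        rw [sub_eq_add_neg, Real.rpow_add hx0 (-1 + b + δ)]; ring
    _ ≤ (2 * C) ^ b * x ^ (-(1 - d)) := by
        gcongr 1
        refine Real.rpow_le_rpow_of_exponent_ge hx0 hx.2.le ?_
        nlinarith

/-! ### The weight `(t (1 - t)) ^ (-β)` -/

/-- The function `(t (1 - t)) ^ (-β)` on `(0, 1)`, extended by `0`. -/
def endWeight (β t : ℝ) : ℝ≥0∞ :=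
  (Ioo (0 : ℝ) 1).indicator (fun t => ENNReal.ofReal ((t * (1 - t)) ^ (-β))) t

theorem endWeight_of_mem {β t : ℝ} (ht : t ∈ Ioo (0 : ℝ) 1) :
    endWeight β t = ENNReal.ofReal ((t * (1 - t)) ^ (-β)) := indicator_of_mem ht _

theorem endWeight_of_notMem {β t : ℝ} (ht : t ∉ Ioo (0 : ℝ) 1) : endWeight β t = 0 :=
  indicator_of_notMem ht _

theorem measurable_endWeight (β : ℝ) : Measurable (endWeight β) :=
  Measurable.indicator (by fun_prop) measurableSet_Ioo

theorem endWeight_ne_top (β t : ℝ) : endWeight β t ≠ ∞ := by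
  by_cases ht : t ∈ Ioo (0 : ℝ) 1
  · rw [endWeight_of_mem ht]; exact ENNReal.ofReal_ne_top
  · rw [endWeight_of_notMem ht]; exact ENNReal.zero_ne_top

theorem endWeight_rpow (β : ℝ) {p : ℝ} (hp : 0 < p) (t : ℝ) :
    endWeight β t ^ p = endWeight (β * p) t := by
  by_cases ht : t ∈ Ioo (0 : ℝ) 1
  · have h : 0 < t * (1 - t) := mul_pos ht.1 (by linarith [ht.2])
    rw [endWeight_of_mem ht, endWeight_of_mem ht, ENNReal.ofReal_rpow_of_pos (by positivity),
      ← Real.rpow_mul h.le, neg_mul]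
  · rw [endWeight_of_notMem ht, endWeight_of_notMem ht, ENNReal.zero_rpow_of_pos hp]

/-- One of `t`, `1 - t` is at least `1/2`, so its factor is at most `2 ^ β`. -/
theorem mul_one_sub_rpow_neg_le {β t : ℝ} (hβ : 0 ≤ β) (ht : t ∈ Ioo (0 : ℝ) 1) :
    (t * (1 - t)) ^ (-β) ≤ 2 ^ β * (t ^ (-β) + (1 - t) ^ (-β)) := by
  have h0 := ht.1
  have h1 : 0 < 1 - t := by linarith [ht.2]
  have half : (1 / 2 : ℝ) ^ (-β) = 2 ^ β := by
    rw [one_div, Real.inv_rpow two_pos.le, Real.rpow_neg two_pos.le, inv_inv]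
  rw [Real.mul_rpow h0.le h1.le, ← half]
  have p0 : 0 < t ^ (-β) := Real.rpow_pos_of_pos h0 _
  have p1 : 0 < (1 - t) ^ (-β) := Real.rpow_pos_of_pos h1 _
  have p2 : 0 < (1 / 2 : ℝ) ^ (-β) := Real.rpow_pos_of_pos (by norm_num) _
  rcases le_total t (1 / 2) with h | h
  · have e : (1 - t) ^ (-β) ≤ (1 / 2 : ℝ) ^ (-β) :=
      Real.rpow_le_rpow_of_nonpos (by norm_num) (by linarith) (by linarith)
    nlinarith [mul_pos p2 p1]
  · have e : t ^ (-β) ≤ (1 / 2 : ℝ) ^ (-β) :=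
      Real.rpow_le_rpow_of_nonpos (by norm_num) (by linarith) (by linarith)
    nlinarith [mul_pos p2 p0]

theorem lintegral_endWeight_lt_top {β : ℝ} (hβ : 0 ≤ β) (hβ1 : β < 1) :
    ∫⁻ t, endWeight β t < ∞ := by
  have hi : IntervalIntegrable (fun t : ℝ => t ^ (-β)) volume 0 1 :=
    intervalIntegral.intervalIntegrable_rpow' (by linarith)
  have hi' : IntervalIntegrable (fun t : ℝ => (1 - t) ^ (-β)) volume 0 1 := by
    have := (hi.comp_sub_left 1).symm
    simpa using this
  have hI : IntegrableOn (fun t : ℝ => 2 ^ β * (t ^ (-β) + (1 - t) ^ (-β))) (Ioo 0 1) :=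
    ((((intervalIntegrable_iff_integrableOn_Ioo_of_le zero_le_one).1 hi).add
      ((intervalIntegrable_iff_integrableOn_Ioo_of_le zero_le_one).1 hi')).const_mul _)
  unfold endWeight
  rw [lintegral_indicator measurableSet_Ioo]
  refine lt_of_le_of_lt (setLIntegral_mono' measurableSet_Ioo fun t ht =>
    ENNReal.ofReal_le_ofReal (mul_one_sub_rpow_neg_le hβ ht)) ?_
  exact hI.lintegral_lt_top

/-! ### Almost sure approximation of the uniform quantile function -/

/-- `Q n` is the quantile function of the distribution function `F n`, `F n` approximates the
uniform distribution function, its tails are bounded below, and its quantile function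
has a bounded moment near the end points of `(0, 1)`. -/
structure QuantileApprox (F Q : ℕ → ℝ → ℝ) (r β : ℝ) : Prop where
  le_iff : ∀ n, 1 ≤ n → ∀ u ∈ Ioo (0 : ℝ) 1, ∀ t, u ≤ F n t ↔ Q n u ≤ t
  tendsto : ∀ q : ℚ, (q : ℝ) ∈ Ioo (0 : ℝ) 1 → Tendsto (fun n => F n q) atTop (𝓝 q)
  left_tail : ∃ C, 0 < C ∧ ∀ᶠ n : ℕ in atTop, ∀ t ∈ Ioo (0 : ℝ) 1,
    t ^ r ≤ C * max (F n t) (1 / n)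
  right_tail : ∃ C, 0 < C ∧ ∀ᶠ n : ℕ in atTop, ∀ t ∈ Ioo (0 : ℝ) 1,
    (1 - t) ^ r ≤ C * max (1 - F n t) (1 / n)
  moment : ∃ A : ℝ≥0∞, A ≠ ∞ ∧ ∀ᶠ n in atTop,
    ∫⁻ u in Ioo (0 : ℝ) 1, endWeight β (Q n u) ≤ A

namespace QuantileApprox

variable {F Q : ℕ → ℝ → ℝ} {r β : ℝ}

/-- By the Galois connection `le_iff`, convergence of `F n` at rationals on either side of `u` traps
`Q n u`. Restricting to rationals keeps the exceptional null set countable in the applications. -/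
theorem tendsto_quantile (h : QuantileApprox F Q r β) {u : ℝ} (hu : u ∈ Ioo (0 : ℝ) 1) :
    Tendsto (fun n => Q n u) atTop (𝓝 u) := by
  rw [tendsto_order]
  constructor
  · intro a ha
    obtain ⟨q, hq1, hq2⟩ := exists_rat_btwn (max_lt ha hu.1)
    have hq : (q : ℝ) ∈ Ioo (0 : ℝ) 1 := ⟨(le_max_right _ _).trans_lt hq1, hq2.trans hu.2⟩
    filter_upwards [(h.tendsto q hq).eventually_lt_const hq2, eventually_ge_atTop 1] with n hn h1
    refine ((le_max_left a 0).trans_lt hq1).trans ?_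
    by_contra hcon
    exact absurd ((h.le_iff n h1 u hu q).2 (not_lt.1 hcon)) (not_le.2 hn)
  · intro a ha
    obtain ⟨q, hq1, hq2⟩ := exists_rat_btwn (lt_min ha hu.2)
    have hq : (q : ℝ) ∈ Ioo (0 : ℝ) 1 := ⟨hu.1.trans hq1, hq2.trans_le (min_le_right _ _)⟩
    filter_upwards [(h.tendsto q hq).eventually_const_lt hq1, eventually_ge_atTop 1] with n hn h1
    exact ((h.le_iff n h1 u hu q).1 hn.le).trans_lt (hq2.trans_le (min_le_left _ _))

theorem aemeasurable_quantile (h : QuantileApprox F Q r β) {n : ℕ} (hn : 1 ≤ n) :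
    AEMeasurable (Q n) (volume.restrict (Ioo (0 : ℝ) 1)) := by
  refine aemeasurable_restrict_of_monotoneOn measurableSet_Ioo fun u hu v hv huv => ?_
  exact (h.le_iff n hn u hu _).1 (huv.trans ((h.le_iff n hn v hv _).2 le_rfl))

theorem exists_tail_bounds (h : QuantileApprox F Q r β) (hr : 0 < r) :
    ∃ C, 0 < C ∧ ∀ᶠ n : ℕ in atTop, ∀ u ∈ Ioo (0 : ℝ) 1, Q n u ∈ Ioo (0 : ℝ) 1 →
      Q n u ^ r ≤ C * max u (1 / n) ∧ (1 - Q n u) ^ r ≤ C * max (1 - u) (1 / n) := by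
  obtain ⟨C₁, hC₁, h₁⟩ := h.left_tail
  obtain ⟨C₂, hC₂, h₂⟩ := h.right_tail
  refine ⟨max C₁ C₂, lt_max_of_lt_left hC₁, ?_⟩
  filter_upwards [h₁, h₂, eventually_ge_atTop 1] with n h₁ h₂ hn u hu hQ
  have hu0 := hu.1
  have hu1 : 0 < 1 - u := by linarith [hu.2]
  constructor
  -- `F n` may jump above `u` at `Q n u`, so the left tail bound is applied at `t < Q n u`, where `F
  -- n t < u`, and `t` is sent to `Q n u`.
  · have hcont : Tendsto (fun t : ℝ => t ^ r) (𝓝[<] (Q n u)) (𝓝 (Q n u ^ r)) :=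
      (Real.continuousAt_rpow_const _ _ (Or.inr hr.le)).tendsto.mono_left nhdsWithin_le_nhds
    refine le_of_tendsto hcont ?_
    filter_upwards [Ioo_mem_nhdsLT hQ.1] with t ht
    have hF : F n t < u := by
      by_contra hcon
      exact absurd ((h.le_iff n hn u hu t).1 (not_lt.1 hcon)) (not_le.2 ht.2)
    refine (h₁ t ⟨ht.1, ht.2.trans hQ.2⟩).trans ?_
    have : max (F n t) (1 / n) ≤ max u (1 / n) := max_le_max hF.le le_rfl
    have h0 : 0 ≤ max (F n t) (1 / (n : ℝ)) := le_max_of_le_right (by positivity)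
    gcongr
    exact le_max_left _ _
  · have hF : u ≤ F n (Q n u) := (h.le_iff n hn u hu _).2 le_rfl
    refine (h₂ _ hQ).trans ?_
    have h0 : 0 ≤ max (1 - F n (Q n u)) (1 / (n : ℝ)) := le_max_of_le_right (by positivity)
    gcongr
    exact le_max_right _ _

end QuantileApprox

/-! ### Convergence of `L`-statistics along approximate quantile functions. -/

theorem measurable_scoreFun (c : ℕ → ℕ → ℝ) (n : ℕ) : Measurable (scoreFun c n) := by
  unfold scoreFun
  refine Measurable.ite measurableSet_Iic measurable_const ?_
  exact (measurable_from_nat (f := c n)).comp (Nat.measurable_ceil.comp (by fun_prop))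

theorem enorm_le_mul_endWeight {x K β t : ℝ} (hK : 0 ≤ K) (ht : t ∈ Ioo (0 : ℝ) 1)
    (h : |x| ≤ K * (t ^ (-β) * (1 - t) ^ (-β))) : ‖x‖ₑ ≤ ENNReal.ofReal K * endWeight β t := by
  rw [endWeight_of_mem ht, ← ENNReal.ofReal_mul hK, Real.enorm_eq_ofReal_abs,
    Real.mul_rpow ht.1.le (by linarith [ht.2])]
  exact ENNReal.ofReal_le_ofReal h

/-- Along quantile functions approximating the uniform one, the `L`-statistics converge: the
difference of the integrands tends to `0` almost everywhere because `g` is almost everywhere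
continuous, and it is bounded in `L^p` with `p = 1 + d`. -/
theorem QuantileApprox.tendsto_integral {F Q : ℕ → ℝ → ℝ} {r d : ℝ}
    (h : QuantileApprox F Q r ((1 - d) * (1 + d))) (hr : 0 < r) (hd : 0 < d) (hd1 : d < 1)
    {g : ℝ → ℝ} (hg : MemG g) {c : ℕ → ℕ → ℝ} {J : ℝ → ℝ}
    {M b₁ b₂ δ : ℝ} (hM : 0 < M) (hb₁ : 0 < b₁) (hb₂ : 0 < b₂) (hdδ : d ≤ δ / 2)
    (hr₁ : (r - 1) * b₁ ≤ δ / 2) (hr₂ : (r - 1) * b₂ ≤ δ / 2)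
    (hbound : BoundednessAssumption g hg c J M b₁ b₂ δ)
    {μinf : ℝ} (hμ : Tendsto (fun n => centering g c n) atTop (𝓝 μinf)) :
    Tendsto (fun n => ∫ u in Ioo (0 : ℝ) 1, (Ioo (0 : ℝ) 1).indicator g (Q n u) * scoreFun c n u)
      atTop (𝓝 μinf) := by
  set μ : Measure ℝ := volume.restrict (Ioo (0 : ℝ) 1) with hμdef
  set G := (Ioo (0 : ℝ) 1).indicator g with hG
  set X : ℕ → ℝ → ℝ := fun n u => G (Q n u) * scoreFun c n u with hX
  set Y : ℕ → ℝ → ℝ := fun n u => G u * scoreFun c n u with hY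
  obtain ⟨C, hC, hCn⟩ := h.exists_tail_bounds hr
  obtain ⟨A, hA, hAn⟩ := h.moment
  have hfin : IsFiniteMeasure μ := ⟨by simp [hμdef]⟩
  set p := 1 + d with hp
  have hp1 : 1 < p := by linarith
  have hp0 : 0 < p := by linarith
  have hXm : ∀ n, 1 ≤ n → AEStronglyMeasurable (X n) μ := fun n hn =>
    ((hg.measurable_indicator.comp_aemeasurable (h.aemeasurable_quantile hn)).mul
      (measurable_scoreFun c n).aemeasurable).aestronglyMeasurable
  have hYm : ∀ n, AEStronglyMeasurable (Y n) μ := fun n =>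
    (hg.measurable_indicator.mul (measurable_scoreFun c n)).aestronglyMeasurable
  set K₁ := M * M * (2 * C) ^ b₁ * (2 * C) ^ b₂ with hK₁
  have hXb : ∀ᶠ n in atTop, ∀ u ∈ Ioo (0 : ℝ) 1,
      ‖X n u‖ₑ ≤ ENNReal.ofReal K₁ * endWeight (1 - d) (Q n u) := by
    filter_upwards [hCn, eventually_ge_atTop 1] with n hn hn1 u hu
    by_cases hQ : Q n u ∈ Ioo (0 : ℝ) 1
    · obtain ⟨t1, t2⟩ := hn u hu hQ
      have hQ' : 1 - Q n u ∈ Ioo (0 : ℝ) 1 := ⟨by linarith [hQ.2], by linarith [hQ.1]⟩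
      refine enorm_le_mul_endWeight (by positivity) hQ ?_
      have e1 := rpow_mul_half_rpow_le hQ hC hb₁ t1 hr₁ hdδ
      have e2 := rpow_mul_half_rpow_le hQ' hC hb₂ t2 hr₂ hdδ
      have e3 := abs_scoreFun_le hn1 hM hb₁ hb₂ (hbound.scoreFun_le n hn1) hu
      have e4 := hbound.g_le _ hQ
      unfold boundD at e4
      have q0 := hQ.1
      have q1 := hQ'.1
      have m1 : 0 < max u (1 / (n : ℝ)) := lt_max_of_lt_left hu.1
      have m2 : 0 < max (1 - u) (1 / (n : ℝ)) := lt_max_of_lt_left (by linarith [hu.2])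
      simp only [hX, hG, indicator_of_mem hQ, abs_mul]
      calc |g (Q n u)| * |scoreFun c n u| ≤ _ := mul_le_mul e4 e3 (abs_nonneg _) (by positivity)
        -- The bounds for `g` and the score are paired end point by end point.
        _ = M * M * ((Q n u ^ (-1 + b₁ + δ) * (max u (1 / n) / 2) ^ (-b₁)) *
            ((1 - Q n u) ^ (-1 + b₂ + δ) * (max (1 - u) (1 / n) / 2) ^ (-b₂))) := by ring
        _ ≤ M * M * (((2 * C) ^ b₁ * Q n u ^ (-(1 - d))) *
            ((2 * C) ^ b₂ * (1 - Q n u) ^ (-(1 - d)))) := by gcongr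
        _ = _ := by rw [hK₁]; ring
    · simp [hX, hG, indicator_of_notMem hQ]
  have hYb : ∀ᶠ n in atTop, ∀ u ∈ Ioo (0 : ℝ) 1,
      ‖Y n u‖ₑ ≤ ENNReal.ofReal (M * M) * endWeight (1 - d) u := by
    filter_upwards [eventually_ge_atTop 1] with n hn1 u hu
    refine enorm_le_mul_endWeight (by positivity) hu ?_
    have e3 := hbound.scoreFun_le n hn1 u hu
    have e4 := hbound.g_le _ hu
    have u0 := hu.1
    have u1 : 0 < 1 - u := by linarith [hu.2]
    unfold boundD at e4
    unfold boundB at e3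
    simp only [hY, hG, indicator_of_mem hu, abs_mul]
    calc |g u| * |scoreFun c n u| ≤ _ := mul_le_mul e4 e3 (abs_nonneg _) (by positivity)
      _ = M * M * ((u ^ (-1 + b₁ + δ) * u ^ (-b₁)) *
            ((1 - u) ^ (-1 + b₂ + δ) * (1 - u) ^ (-b₂))) := by ring
      _ = M * M * (u ^ (-1 + δ) * (1 - u) ^ (-1 + δ)) := by
          rw [← Real.rpow_add u0, ← Real.rpow_add u1]; ring_nf
      _ ≤ M * M * (u ^ (-(1 - d)) * (1 - u) ^ (-(1 - d))) := by
          have a1 : u ^ (-1 + δ) ≤ u ^ (-(1 - d)) :=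
            Real.rpow_le_rpow_of_exponent_ge u0 hu.2.le (by linarith)
          have a2 : (1 - u) ^ (-1 + δ) ≤ (1 - u) ^ (-(1 - d)) :=
            Real.rpow_le_rpow_of_exponent_ge u1 (by linarith) (by linarith)
          gcongr
  have hβ0 : 0 ≤ (1 - d) * p := mul_nonneg (by linarith) hp0.le
  -- Here `(1 - d) * p = 1 - d ^ 2`.
  have hβ1 : (1 - d) * p < 1 := by rw [hp]; nlinarith
  have hXi : ∀ᶠ n in atTop, ∫⁻ u, ‖X n u‖ₑ ^ p ∂μ ≤ ENNReal.ofReal K₁ ^ p * A := by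
    filter_upwards [hXb, hAn] with n hn hAn
    calc ∫⁻ u, ‖X n u‖ₑ ^ p ∂μ
        ≤ ∫⁻ u, ENNReal.ofReal K₁ ^ p * endWeight ((1 - d) * p) (Q n u) ∂μ := by
          refine setLIntegral_mono' measurableSet_Ioo fun u hu => ?_
          rw [← endWeight_rpow _ hp0, ← ENNReal.mul_rpow_of_nonneg _ _ hp0.le]
          exact ENNReal.rpow_le_rpow (hn u hu) hp0.le
      _ = ENNReal.ofReal K₁ ^ p * ∫⁻ u, endWeight ((1 - d) * p) (Q n u) ∂μ :=
          lintegral_const_mul' _ _ (ENNReal.rpow_ne_top_of_nonneg hp0.le ENNReal.ofReal_ne_top)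
      _ ≤ _ := by gcongr
  set A' := ∫⁻ u, endWeight ((1 - d) * p) u with hA'
  have hYi : ∀ᶠ n in atTop, ∫⁻ u, ‖Y n u‖ₑ ^ p ∂μ ≤ ENNReal.ofReal (M * M) ^ p * A' := by
    filter_upwards [hYb] with n hn
    calc ∫⁻ u, ‖Y n u‖ₑ ^ p ∂μ
        ≤ ∫⁻ u, ENNReal.ofReal (M * M) ^ p * endWeight ((1 - d) * p) u ∂μ := by
          refine setLIntegral_mono' measurableSet_Ioo fun u hu => ?_
          rw [← endWeight_rpow _ hp0, ← ENNReal.mul_rpow_of_nonneg _ _ hp0.le]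
          exact ENNReal.rpow_le_rpow (hn u hu) hp0.le
      _ = ENNReal.ofReal (M * M) ^ p * ∫⁻ u, endWeight ((1 - d) * p) u ∂μ :=
          lintegral_const_mul' _ _ (ENNReal.rpow_ne_top_of_nonneg hp0.le ENNReal.ofReal_ne_top)
      _ ≤ _ := by
          gcongr
          exact setLIntegral_le_lintegral _ _
  have hXA : ENNReal.ofReal K₁ ^ p * A ≠ ∞ :=
    ENNReal.mul_ne_top (ENNReal.rpow_ne_top_of_nonneg hp0.le ENNReal.ofReal_ne_top) hA
  have hYA : ENNReal.ofReal (M * M) ^ p * A' ≠ ∞ :=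
    ENNReal.mul_ne_top (ENNReal.rpow_ne_top_of_nonneg hp0.le ENNReal.ofReal_ne_top)
      (lintegral_endWeight_lt_top hβ0 hβ1).ne
  have hlim : ∀ᵐ u ∂μ, Tendsto (fun n => X n u - Y n u) atTop (𝓝 0) := by
    rw [hμdef, ae_restrict_iff' measurableSet_Ioo]
    filter_upwards [hg.ae_continuousAt] with u hcont hu
    have hGc : ContinuousAt G u := by
      refine (hcont hu).congr ?_
      filter_upwards [Ioo_mem_nhds hu.1 hu.2] with s hs
      exact (indicator_of_mem hs g).symm
    have h1 : Tendsto (fun n => G (Q n u) - G u) atTop (𝓝 0) := by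
      have := (hGc.tendsto.comp (h.tendsto_quantile hu)).sub_const (G u)
      simpa using this
    have h2 : Tendsto (fun n => (G (Q n u) - G u) * scoreFun c n u) atTop (𝓝 0) := by
      refine Tendsto.zero_mul_isBoundedUnder_le h1 ?_
      refine isBoundedUnder_of_eventually_le (a := boundB M b₁ b₂ u) ?_
      filter_upwards [eventually_ge_atTop 1] with n hn
      exact hbound.scoreFun_le n hn u hu
    refine h2.congr fun n => ?_
    simp only [hX, hY]; ring
  have hdiff := tendsto_lintegral_enorm_of_rpow_le (μ := μ) (h := fun n u => X n u - Y n u)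
    (p := p) (A := 2 ^ (p - 1) * (ENNReal.ofReal K₁ ^ p * A + ENNReal.ofReal (M * M) ^ p * A'))
    ((eventually_ge_atTop 1).mono fun n hn => (hXm n hn).sub (hYm n)) hlim hp1
    (ENNReal.mul_ne_top (ENNReal.rpow_ne_top_of_nonneg (by linarith) (by simp))
      (ENNReal.add_ne_top.2 ⟨hXA, hYA⟩)) (by
      filter_upwards [hXi, hYi, eventually_ge_atTop 1] with n h1 h2 hn
      calc ∫⁻ u, ‖X n u - Y n u‖ₑ ^ p ∂μ
          ≤ ∫⁻ u, 2 ^ (p - 1) * (‖X n u‖ₑ ^ p + ‖Y n u‖ₑ ^ p) ∂μ := by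
            refine lintegral_mono fun u => ?_
            refine le_trans ?_ (ENNReal.rpow_add_le_mul_rpow_add_rpow _ _ hp1.le)
            gcongr
            exact enorm_sub_le
        _ = 2 ^ (p - 1) * (∫⁻ u, ‖X n u‖ₑ ^ p ∂μ + ∫⁻ u, ‖Y n u‖ₑ ^ p ∂μ) := by
            rw [lintegral_const_mul' _ _
              (ENNReal.rpow_ne_top_of_nonneg (by linarith) (by simp)),
              lintegral_add_left' ((hXm n hn).enorm.pow_const p)]
        _ ≤ _ := by gcongr)
  have hint : Tendsto (fun n => ∫ u, (X n u - Y n u) ∂μ) atTop (𝓝 0) := by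
    rw [tendsto_zero_iff_enorm_tendsto_zero]
    exact tendsto_of_tendsto_of_tendsto_of_le_of_le tendsto_const_nhds hdiff
      (fun _ => zero_le) (fun n => enorm_integral_le_lintegral_enorm _)
  have := hint.add hμ
  rw [zero_add] at this
  refine this.congr' ?_
  filter_upwards [hXi, hYi, eventually_ge_atTop 1] with n h1 h2 hn
  have iX := integrable_of_lintegral_rpow_lt_top (hXm n hn) hp1 (h1.trans_lt hXA.lt_top)
  have iY := integrable_of_lintegral_rpow_lt_top (hYm n) hp1 (h2.trans_lt hYA.lt_top)
  have hcent : centering g c n = ∫ u, Y n u ∂μ := by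
    unfold centering
    refine setIntegral_congr_fun measurableSet_Ioo fun u hu => ?_
    simp only [hY, hG, indicator_of_mem hu]
  rw [hcent, integral_sub iX iY, sub_add_cancel]

/-! ### Exponential bounds for sums of independent variables in `[0, 1]` -/

/-- By convexity the exponential lies below its chord, and `exp (-1) ≤ 1 / 2`. -/
theorem exp_neg_le_one_sub_half {x : ℝ} (hx : x ∈ Icc (0 : ℝ) 1) : Real.exp (-x) ≤ 1 - x / 2 := by
  have h := convexOn_exp.2 (mem_univ (0 : ℝ)) (mem_univ (-1 : ℝ)) (sub_nonneg.2 hx.2) hx.1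
    (by ring)
  simp only [smul_eq_mul, mul_zero, zero_add, mul_neg, mul_one, Real.exp_zero] at h
  have he : Real.exp (-1) ≤ 1 / 2 := by
    rw [Real.exp_neg, ← one_div]
    exact one_div_le_one_div_of_le two_pos (by linarith [Real.add_one_le_exp 1])
  nlinarith [hx.1]

theorem exp_le_one_add_two_mul {x : ℝ} (hx : x ∈ Icc (0 : ℝ) 1) : Real.exp x ≤ 1 + 2 * x := by
  have h := convexOn_exp.2 (mem_univ (0 : ℝ)) (mem_univ (1 : ℝ)) (sub_nonneg.2 hx.2) hx.1
    (by ring)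
  simp only [smul_eq_mul, mul_zero, zero_add, mul_one, Real.exp_zero] at h
  nlinarith [hx.1, Real.exp_one_lt_three]

section Sampling

variable {Ω : Type*} [MeasurableSpace Ω] {P : Measure Ω}

theorem integrable_of_mem_Icc [IsProbabilityMeasure P] {X : Ω → ℝ} (hm : Measurable X) {a b : ℝ}
    (h : ∀ ω, X ω ∈ Icc a b) : Integrable X P :=
  Integrable.of_mem_Icc a b hm.aemeasurable (Eventually.of_forall h)

theorem integrable_exp_mul_sum [IsProbabilityMeasure P] {X : ℕ → Ω → ℝ}
    (hm : ∀ i, Measurable (X i))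
    (h01 : ∀ i ω, X i ω ∈ Icc (0 : ℝ) 1) (n : ℕ) (s : ℝ) :
    Integrable (fun ω => Real.exp (s * (∑ i ∈ Finset.range n, X i) ω)) P := by
  refine integrable_of_mem_Icc (a := 0) (b := Real.exp (|s| * n)) (by fun_prop) fun ω => ?_
  refine ⟨(Real.exp_pos _).le, Real.exp_le_exp.2 ?_⟩
  have h0 : 0 ≤ (∑ i ∈ Finset.range n, X i) ω := by
    rw [Finset.sum_apply]
    exact Finset.sum_nonneg fun i _ => (h01 i ω).1
  have h1 : (∑ i ∈ Finset.range n, X i) ω ≤ n := by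
    rw [Finset.sum_apply]
    refine (Finset.sum_le_sum fun i _ => (h01 i ω).2).trans ?_
    simp
  exact (mul_le_mul_of_nonneg_right (le_abs_self s) h0).trans
    (mul_le_mul_of_nonneg_left h1 (abs_nonneg s))

/-- Chernoff's bound at parameter `-1`: each moment generating function is at most `exp (-m / 2)`,
and half of that gain pays for the threshold. Only a bound on the means enters. -/
theorem measure_sum_le_quarter [IsProbabilityMeasure P] {X : ℕ → Ω → ℝ}
    (hm : ∀ i, Measurable (X i))
    (hind : iIndepFun X P) (h01 : ∀ i ω, X i ω ∈ Icc (0 : ℝ) 1) {m : ℝ}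
    (hmean : ∀ i, m ≤ ∫ ω, X i ω ∂P) (n : ℕ) :
    P.real {ω | ∑ i ∈ Finset.range n, X i ω ≤ n * m / 4} ≤ Real.exp (-(n * m / 4)) := by
  have h := measure_le_le_exp_mul_mgf (μ := P) (X := ∑ i ∈ Finset.range n, X i) (t := -1)
    (n * m / 4) (by norm_num) (integrable_exp_mul_sum hm h01 n _)
  simp only [Finset.sum_apply] at h
  refine h.trans ?_
  rw [hind.mgf_sum hm]
  have hmgf : ∀ i, mgf (X i) P (-1) ≤ Real.exp (-(m / 2)) := by
    intro i
    have hi := integrable_of_mem_Icc (P := P) (hm i) (h01 i)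
    calc mgf (X i) P (-1) ≤ ∫ ω, (1 - X i ω / 2) ∂P := by
          refine integral_mono ?_ ((integrable_const _).sub (hi.div_const 2)) fun ω => ?_
          · refine integrable_of_mem_Icc (a := 0) (b := 1) (by fun_prop) fun ω => ?_
            exact ⟨(Real.exp_pos _).le, Real.exp_le_one_iff.2 (by linarith [(h01 i ω).1])⟩
          · simp only [neg_mul, one_mul]
            exact exp_neg_le_one_sub_half (h01 i ω)
      _ = 1 - (∫ ω, X i ω ∂P) / 2 := by
          rw [integral_sub (integrable_const _) (hi.div_const 2), integral_div]; simp
      _ ≤ 1 - m / 2 := by linarith [hmean i]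
      _ ≤ _ := by linarith [Real.add_one_le_exp (-(m / 2))]
  calc Real.exp (- -1 * (n * m / 4)) * ∏ i ∈ Finset.range n, mgf (X i) P (-1)
      ≤ Real.exp (- -1 * (n * m / 4)) * ∏ _i ∈ Finset.range n, Real.exp (-(m / 2)) := by
        gcongr with i _
        · exact fun i _ => mgf_nonneg
        · exact hmgf i
    _ = Real.exp (-(n * m / 4)) := by
        rw [Finset.prod_const, Finset.card_range, ← Real.exp_nat_mul, ← Real.exp_add]
        congr 1; ring

/-- Chernoff's bound at parameter `1`: each moment generating function is at most `exp (2 * m)`,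
against `exp (-3 * n * m)` from the threshold. -/
theorem measure_three_mul_le_sum [IsProbabilityMeasure P] {X : ℕ → Ω → ℝ}
    (hm : ∀ i, Measurable (X i))
    (hind : iIndepFun X P) (h01 : ∀ i ω, X i ω ∈ Icc (0 : ℝ) 1) {m : ℝ}
    (hmean : ∀ i, ∫ ω, X i ω ∂P ≤ m) (n : ℕ) :
    P.real {ω | 3 * (n * m) ≤ ∑ i ∈ Finset.range n, X i ω} ≤ Real.exp (-(n * m)) := by
  have h := measure_ge_le_exp_mul_mgf (μ := P) (X := ∑ i ∈ Finset.range n, X i) (t := 1)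
    (3 * (n * m)) (by norm_num) (integrable_exp_mul_sum hm h01 n _)
  simp only [Finset.sum_apply] at h
  refine h.trans ?_
  rw [hind.mgf_sum hm]
  have hmgf : ∀ i, mgf (X i) P 1 ≤ Real.exp (2 * m) := by
    intro i
    have hi := integrable_of_mem_Icc (P := P) (hm i) (h01 i)
    calc mgf (X i) P 1 ≤ ∫ ω, (1 + 2 * X i ω) ∂P := by
          refine integral_mono ?_ ((integrable_const _).add (hi.const_mul 2)) fun ω => ?_
          · refine integrable_of_mem_Icc (a := 0) (b := Real.exp 1) (by fun_prop) fun ω => ?_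
            exact ⟨(Real.exp_pos _).le, Real.exp_le_exp.2 (by linarith [(h01 i ω).2])⟩
          · simp only [one_mul]
            exact exp_le_one_add_two_mul (h01 i ω)
      _ = 1 + 2 * (∫ ω, X i ω ∂P) := by
          rw [integral_add (integrable_const _) (hi.const_mul 2), integral_const_mul]; simp
      _ ≤ 1 + 2 * m := by linarith [hmean i]
      _ ≤ _ := by linarith [Real.add_one_le_exp (2 * m)]
  calc Real.exp (-1 * (3 * (n * m))) * ∏ i ∈ Finset.range n, mgf (X i) P 1
      ≤ Real.exp (-1 * (3 * (n * m))) * ∏ _i ∈ Finset.range n, Real.exp (2 * m) := by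
        gcongr with i _
        · exact fun i _ => mgf_nonneg
        · exact hmgf i
    _ = Real.exp (-(n * m)) := by
        rw [Finset.prod_const, Finset.card_range, ← Real.exp_nat_mul, ← Real.exp_add]
        congr 1; ring

/-! ### Borel–Cantelli with stretched exponential bounds -/

theorem summable_nat_mul_exp_neg_rpow {c a : ℝ} (hc : 0 < c) (ha : 0 < a) :
    Summable fun n : ℕ => (n : ℝ) * Real.exp (-(c * (n : ℝ) ^ a)) := by
  -- The exponent makes `(n ^ a) ^ (-3 / a) = n ^ (-3)`, so the terms are `O(n ^ (-2))`.
  have h1 := (isLittleO_exp_neg_mul_rpow_atTop hc (-3 / a)).isBigO.comp_tendsto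
    ((tendsto_rpow_atTop ha).comp tendsto_natCast_atTop_atTop)
  have h2 := (Asymptotics.isBigO_refl (fun n : ℕ => (n : ℝ)) atTop).mul h1
  refine summable_of_isBigO_nat (g := fun n : ℕ => (n : ℝ) ^ (-2 : ℝ))
    (Real.summable_nat_rpow.2 (by norm_num)) ?_
  refine (h2.congr_left fun n => ?_).trans_eventuallyEq ?_
  · simp [neg_mul]
  · filter_upwards [eventually_ge_atTop 1] with n hn
    have hn0 : (0 : ℝ) < n := by exact_mod_cast hn
    simp only [Function.comp_apply]
    rw [← Real.rpow_mul hn0.le, show a * (-3 / a) = -3 by field_simp]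
    nth_rewrite 1 [← Real.rpow_one (n : ℝ)]
    rw [← Real.rpow_add hn0]; norm_num

theorem ae_eventually_notMem_of_real_le [IsProbabilityMeasure P] {s : ℕ → Set Ω}
    {f : ℕ → ℝ} (hf : Summable f)
    (h : ∀ᶠ n in atTop, P.real (s n) ≤ f n) : ∀ᵐ ω ∂P, ∀ᶠ n in atTop, ω ∉ s n := by
  obtain ⟨N, hN⟩ := eventually_atTop.1 h
  have hsum : ∑' n, P (s (n + N)) ≠ ∞ := by
    have hf' : Summable fun n => f (n + N) := (summable_nat_add_iff N).2 hf
    refine ne_top_of_le_ne_top hf'.tsum_ofReal_ne_top (ENNReal.tsum_le_tsum fun n => ?_)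
    rw [← ofReal_measureReal]
    exact ENNReal.ofReal_le_ofReal (hN _ (by omega))
  filter_upwards [ae_eventually_notMem hsum] with ω hω
  obtain ⟨k, hk⟩ := eventually_atTop.1 hω
  refine eventually_atTop.2 ⟨k + N, fun n hn => ?_⟩
  have := hk (n - N) (by omega)
  rwa [Nat.sub_add_cancel (by omega)] at this

/-! ### Uniform samples -/

theorem map_one_sub_uniform {X : Ω → ℝ} (hX : Measurable X)
    (h : P.map X = volume.restrict (Ioo (0 : ℝ) 1)) :
    P.map (fun ω => 1 - X ω) = volume.restrict (Ioo (0 : ℝ) 1) := by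
  have hm : Measurable fun x : ℝ => 1 - x := by fun_prop
  have h1 : P.map (fun ω => 1 - X ω) = (P.map X).map (fun x => 1 - x) :=
    (Measure.map_map hm hX).symm
  have h2 : (fun x : ℝ => 1 - x) ⁻¹' (Ioo (0 : ℝ) 1) = Ioo (0 : ℝ) 1 := by
    ext x; simp only [mem_preimage, mem_Ioo]; constructor <;> rintro ⟨_, _⟩ <;> constructor <;>
      linarith
  rw [h1, h]
  have h3 := (Measure.measurePreserving_sub_left volume (1 : ℝ)).restrict_preimage
    (measurableSet_Ioo (a := (0 : ℝ)) (b := 1))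
  rw [h2] at h3
  exact h3.map_eq

theorem ae_tendsto_average {ξ : ℕ → Ω → ℝ} (hm : ∀ i, Measurable (ξ i)) (hind : iIndepFun ξ P)
    (hu : ∀ i, P.map (ξ i) = volume.restrict (Ioo (0 : ℝ) 1)) {φ : ℝ → ℝ} (hφ : Measurable φ)
    (hi : IntegrableOn φ (Ioo (0 : ℝ) 1)) :
    ∀ᵐ ω ∂P, Tendsto (fun n : ℕ => (∑ i ∈ Finset.range n, φ (ξ i ω)) / n) atTop
      (𝓝 (∫ t in Ioo (0 : ℝ) 1, φ t)) := by
  have h := strong_law_ae_real (μ := P) (fun i ω => φ (ξ i ω)) ?_ ?_ ?_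
  · have e : ∫ ω, φ (ξ 0 ω) ∂P = ∫ t in Ioo (0 : ℝ) 1, φ t := by
      rw [← hu 0, integral_map (hm 0).aemeasurable hφ.aestronglyMeasurable]
    rw [e] at h
    exact h
  · rw [IntegrableOn, ← hu 0] at hi
    exact hi.comp_measurable (hm 0)
  · intro i j hij
    exact (hind.indepFun hij).comp hφ hφ
  · intro i
    exact IdentDistrib.comp ⟨(hm i).aemeasurable, (hm 0).aemeasurable, (hu i).trans (hu 0).symm⟩ hφ

theorem measure_count_le_quarter_le_exp [IsProbabilityMeasure P] {ξ : ℕ → Ω → ℝ}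
    (hm : ∀ i, Measurable (ξ i)) (hind : iIndepFun ξ P)
    (hu : ∀ i, P.map (ξ i) = volume.restrict (Ioo (0 : ℝ) 1)) {n : ℕ} (hn : 1 ≤ n) {j : ℕ}
    (hj : j ≤ n) :
    P.real {ω | ∑ i ∈ Finset.range n, (Iio ((j : ℝ) / n)).indicator (1 : ℝ → ℝ) (ξ i ω) ≤
      (j : ℝ) / 4} ≤ Real.exp (-((j : ℝ) / 4)) := by
  have hn0 : (0 : ℝ) < n := by exact_mod_cast hn
  have hjn : (j : ℝ) / n ≤ 1 := (div_le_one hn0).2 (by exact_mod_cast hj)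
  have hφ : Measurable ((Iio ((j : ℝ) / n)).indicator (1 : ℝ → ℝ)) :=
    measurable_one.indicator measurableSet_Iio
  have h := measure_sum_le_quarter (P := P)
    (X := fun i ω => (Iio ((j : ℝ) / n)).indicator (1 : ℝ → ℝ) (ξ i ω)) (m := (j : ℝ) / n)
    (fun i => hφ.comp (hm i)) (hind.comp (fun _ => _) fun _ => hφ) ?_ ?_ n
  · rwa [mul_div_cancel₀ _ hn0.ne'] at h
  · intro i ω
    by_cases hω : ξ i ω ∈ Iio ((j : ℝ) / n)
    · simp [indicator_of_mem hω]
    · simp [indicator_of_notMem hω]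
  · intro i
    have hpos : 0 ≤ (j : ℝ) / n := by positivity
    have e : ∫ ω, (Iio ((j : ℝ) / n)).indicator (1 : ℝ → ℝ) (ξ i ω) ∂P = (j : ℝ) / n := by
      rw [← integral_map (f := (Iio ((j : ℝ) / n)).indicator (1 : ℝ → ℝ)) (hm i).aemeasurable
        hφ.aestronglyMeasurable, hu i, integral_indicator_one measurableSet_Iio,
        measureReal_restrict_apply measurableSet_Iio]
      have : Iio ((j : ℝ) / n) ∩ Ioo 0 1 = Ioo 0 ((j : ℝ) / n) := by
        ext x; simp only [mem_inter_iff, mem_Iio, mem_Ioo]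
        constructor
        · rintro ⟨h1, h2, h3⟩; exact ⟨h2, h1⟩
        · rintro ⟨h1, h2⟩; exact ⟨h2, h1, h2.trans_le hjn⟩
      rw [this]
      simp [Measure.real, hpos]
    exact e.ge

/-- Lower bound for the left tail of the empirical distribution function, from exponential bounds
at the points `j / n`. -/
theorem ae_eventually_rpow_le_strict [IsProbabilityMeasure P] {ξ : ℕ → Ω → ℝ}
    (hm : ∀ i, Measurable (ξ i))
    (hind : iIndepFun ξ P) (hu : ∀ i, P.map (ξ i) = volume.restrict (Ioo (0 : ℝ) 1)) {r : ℝ}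
    (hr : 1 < r) :
    ∀ᵐ ω ∂P, ∀ᶠ n : ℕ in atTop, ∀ t ∈ Ioo (0 : ℝ) 1,
      t ^ r ≤ 8 ^ r *
        max ((∑ i ∈ Finset.range n, (Iio t).indicator (1 : ℝ → ℝ) (ξ i ω)) / n) (1 / n) := by
  -- Grid points `j / n` with `j ≥ n ^ a` have summable failure probabilities. Below that scale `t`
  -- is of order at most `n ^ (a - 1) = n ^ (-1 / r)`, so `t ^ r` is `O(1 / n)` without any
  -- randomness.
  set a : ℝ := 1 - 1 / r with ha
  have hr0 : 0 < r := by linarith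
  have ha0 : 0 < a := by
    have : 1 / r < 1 := (div_lt_one hr0).2 hr
    linarith
  set bad : ℕ → Set Ω := fun n =>
    ⋃ j ∈ (Finset.range (n + 1)).filter (fun j : ℕ => (n : ℝ) ^ a ≤ j),
    {ω | ∑ i ∈ Finset.range n, (Iio ((j : ℝ) / n)).indicator (1 : ℝ → ℝ) (ξ i ω) ≤
      (j : ℝ) / 4} with hbad
  have hbadm : ∀ᶠ n : ℕ in atTop, P.real (bad n) ≤
      2 * ((n : ℝ) * Real.exp (-((1 / 4) * (n : ℝ) ^ a))) := by
    filter_upwards [eventually_ge_atTop 1] with n hn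
    have hn1 : (1 : ℝ) ≤ n := by exact_mod_cast hn
    refine (measureReal_biUnion_finset_le _ _).trans ?_
    calc _ ≤ ∑ j ∈ (Finset.range (n + 1)).filter (fun j : ℕ => (n : ℝ) ^ a ≤ j),
          Real.exp (-((1 / 4) * (n : ℝ) ^ a)) := by
          refine Finset.sum_le_sum fun j hj => ?_
          rw [Finset.mem_filter, Finset.mem_range] at hj
          refine (measure_count_le_quarter_le_exp hm hind hu hn (by omega)).trans
            (Real.exp_le_exp.2 ?_)
          linarith [hj.2]
      _ ≤ (n + 1) * Real.exp (-((1 / 4) * (n : ℝ) ^ a)) := by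
          rw [Finset.sum_const, nsmul_eq_mul]
          gcongr
          have := Finset.card_filter_le (Finset.range (n + 1)) (fun j : ℕ => (n : ℝ) ^ a ≤ j)
          rw [Finset.card_range] at this
          exact_mod_cast this
      _ ≤ _ := by
          rw [← mul_assoc]
          gcongr
          linarith
  filter_upwards [ae_eventually_notMem_of_real_le
    ((summable_nat_mul_exp_neg_rpow (by norm_num : (0 : ℝ) < 1 / 4) ha0).mul_left 2) hbadm]
    with ω hω
  filter_upwards [hω, eventually_ge_atTop 1] with n hn hn1 t ht
  have hn1' : (1 : ℝ) ≤ n := by exact_mod_cast hn1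
  have hn0 : (0 : ℝ) < n := by linarith
  have hna : 1 ≤ (n : ℝ) ^ a := Real.one_le_rpow hn1' ha0.le
  have ht0 := ht.1
  set j := ⌊(n : ℝ) * t⌋₊ with hj
  have hjle : (j : ℝ) ≤ n * t := Nat.floor_le (by positivity)
  have hjlt : (n : ℝ) * t < j + 1 := Nat.lt_floor_add_one _
  have h8 : (8 : ℝ) ≤ 8 ^ r := by
    nth_rewrite 1 [← Real.rpow_one 8]
    exact Real.rpow_le_rpow_of_exponent_le (by norm_num) hr.le
  rcases le_or_gt ((n : ℝ) ^ a) j with hja | hja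
  · have hjn : j < n + 1 := by
      have : (j : ℝ) < n + 1 := by nlinarith [ht.2]
      exact_mod_cast this
    have hgood : (j : ℝ) / 4 <
        ∑ i ∈ Finset.range n, (Iio ((j : ℝ) / n)).indicator (1 : ℝ → ℝ) (ξ i ω) := by
      by_contra hcon
      exact hn (mem_biUnion (x := j) (by simp [Nat.lt_succ_iff.1 hjn, hja]) (not_lt.1 hcon))
    have hmono : ∑ i ∈ Finset.range n, (Iio ((j : ℝ) / n)).indicator (1 : ℝ → ℝ) (ξ i ω) ≤
        ∑ i ∈ Finset.range n, (Iio t).indicator (1 : ℝ → ℝ) (ξ i ω) := by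
      refine Finset.sum_le_sum fun i _ => ?_
      refine indicator_le_indicator_of_subset (Iio_subset_Iio ?_) (fun _ => zero_le_one) _
      rw [div_le_iff₀ hn0]; linarith
    set S := ∑ i ∈ Finset.range n, (Iio t).indicator (1 : ℝ → ℝ) (ξ i ω) with hS
    -- Since `j ≥ 1`, `n * t < j + 1 ≤ 2 * j < 8 * S`.
    have hSn : t ≤ 8 * (S / n) := by
      rw [← mul_div_assoc, le_div_iff₀ hn0]
      linarith
    have hS0 : 0 ≤ S / n := by linarith
    calc t ^ r ≤ t := by
          nth_rewrite 2 [← Real.rpow_one t]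
          exact Real.rpow_le_rpow_of_exponent_ge ht0 ht.2.le hr.le
      _ ≤ 8 * (S / n) := hSn
      _ ≤ 8 ^ r * (S / n) := by gcongr
      _ ≤ _ := by gcongr; exact le_max_left _ _
  · have h1 : t ≤ 8 * (n : ℝ) ^ (-(1 / r)) := by
      have e : (n : ℝ) * (n : ℝ) ^ (-(1 / r)) = (n : ℝ) ^ a := by
        nth_rewrite 1 [← Real.rpow_one (n : ℝ)]
        rw [← Real.rpow_add hn0, ha]; ring_nf
      refine le_of_mul_le_mul_left ?_ hn0
      rw [mul_left_comm, e]
      linarith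
    calc t ^ r ≤ (8 * (n : ℝ) ^ (-(1 / r))) ^ r := Real.rpow_le_rpow ht0.le h1 hr0.le
      _ = 8 ^ r * (1 / n) := by
          rw [Real.mul_rpow (by norm_num) (by positivity), ← Real.rpow_mul hn0.le,
            show -(1 / r) * r = -1 by field_simp, Real.rpow_neg_one, one_div]
      _ ≤ _ := by gcongr; exact le_max_right _ _

end Sampling

/-! ### The empirical distribution function -/

/-- The empirical distribution function of `x 0, …, x (n - 1)`. -/
def empiricalCDF (x : ℕ → ℝ) (n : ℕ) (t : ℝ) : ℝ :=
  (∑ i ∈ Finset.range n, (Iic t).indicator (1 : ℝ → ℝ) (x i)) / n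

/-- The sample `x` has an empirical distribution function that is close to the uniform one. -/
structure UniformSample (x : ℕ → ℝ) (r : ℝ) : Prop where
  mem : ∀ i, x i ∈ Ioo (0 : ℝ) 1
  tendsto : ∀ q : ℚ, (q : ℝ) ∈ Ioo (0 : ℝ) 1 →
    Tendsto (fun n => empiricalCDF x n q) atTop (𝓝 q)
  left_tail : ∃ C, 0 < C ∧ ∀ᶠ n : ℕ in atTop, ∀ t ∈ Ioo (0 : ℝ) 1,
    t ^ r ≤ C * max (empiricalCDF x n t) (1 / n)
  right_tail : ∃ C, 0 < C ∧ ∀ᶠ n : ℕ in atTop, ∀ t ∈ Ioo (0 : ℝ) 1,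
    (1 - t) ^ r ≤ C * max (1 - empiricalCDF x n t) (1 / n)

/-- Reflection turns the right tail into a left tail of the sample `1 - x i`, which is again
uniform. The complement of `Iic t` becomes an open half-line, which is why the tail estimate is
proved for strict counts. -/
theorem one_sub_empiricalCDF (x : ℕ → ℝ) {n : ℕ} (hn : 1 ≤ n) (t : ℝ) :
    1 - empiricalCDF x n t =
      (∑ i ∈ Finset.range n, (Iio (1 - t)).indicator (1 : ℝ → ℝ) (1 - x i)) / n := by
  have hn0 : (n : ℝ) ≠ 0 := by positivity
  have e : ∀ i, (Iio (1 - t)).indicator (1 : ℝ → ℝ) (1 - x i) =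
      1 - (Iic t).indicator (1 : ℝ → ℝ) (x i) := by
    intro i
    by_cases h : x i ≤ t
    · rw [indicator_of_mem (show x i ∈ Iic t from h), indicator_of_notMem]
      · simp
      · simp only [mem_Iio, not_lt]; linarith
    · rw [indicator_of_notMem (show x i ∉ Iic t from h), indicator_of_mem]
      · simp
      · simp only [mem_Iio]; linarith [not_le.1 h]
  unfold empiricalCDF
  simp_rw [e]
  rw [Finset.sum_sub_distrib]
  simp only [Finset.sum_const, Finset.card_range, nsmul_eq_mul, mul_one]
  field_simp

theorem ae_uniformSample {Ω : Type*} [MeasurableSpace Ω] {P : Measure Ω} [IsProbabilityMeasure P]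
    {ξ : ℕ → Ω → ℝ} (hm : ∀ i, Measurable (ξ i)) (hind : iIndepFun ξ P)
    (hu : ∀ i, P.map (ξ i) = volume.restrict (Ioo (0 : ℝ) 1)) {r : ℝ} (hr : 1 < r) :
    ∀ᵐ ω ∂P, UniformSample (fun i => ξ i ω) r := by
  have hmem : ∀ᵐ ω ∂P, ∀ i, ξ i ω ∈ Ioo (0 : ℝ) 1 := by
    rw [ae_all_iff]
    intro i
    refine ae_of_ae_map (hm i).aemeasurable (p := fun y => y ∈ Ioo (0 : ℝ) 1) ?_
    rw [hu i]
    exact ae_restrict_mem measurableSet_Ioo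
  have hlim : ∀ᵐ ω ∂P, ∀ q : ℚ, (q : ℝ) ∈ Ioo (0 : ℝ) 1 →
      Tendsto (fun n => empiricalCDF (fun i => ξ i ω) n q) atTop (𝓝 q) := by
    rw [ae_all_iff]
    intro q
    by_cases hq : (q : ℝ) ∈ Ioo (0 : ℝ) 1
    · have hφ : Measurable ((Iic (q : ℝ)).indicator (1 : ℝ → ℝ)) :=
        measurable_one.indicator measurableSet_Iic
      have hi : IntegrableOn ((Iic (q : ℝ)).indicator (1 : ℝ → ℝ)) (Ioo (0 : ℝ) 1) :=
        (integrableOn_const (C := (1 : ℝ)) (by simp)).indicator measurableSet_Iic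
      have e : ∫ t in Ioo (0 : ℝ) 1, (Iic (q : ℝ)).indicator (1 : ℝ → ℝ) t = q := by
        rw [integral_indicator_one measurableSet_Iic, measureReal_restrict_apply measurableSet_Iic]
        have : Iic (q : ℝ) ∩ Ioo 0 1 = Ioc 0 (q : ℝ) := by
          ext x; simp only [mem_inter_iff, mem_Iic, mem_Ioo, mem_Ioc]
          constructor
          · rintro ⟨h1, h2, h3⟩; exact ⟨h2, h1⟩
          · rintro ⟨h1, h2⟩; exact ⟨h2, h1, h2.trans_lt hq.2⟩
        rw [this, Real.volume_real_Ioc_of_le hq.1.le, sub_zero]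
      have := ae_tendsto_average hm hind hu hφ hi
      rw [e] at this
      filter_upwards [this] with ω hω _
      exact hω
    · exact Eventually.of_forall fun ω h => absurd h hq
  have hm' : ∀ i, Measurable fun ω => 1 - ξ i ω := fun i => measurable_const.sub (hm i)
  have hind' : iIndepFun (fun i ω => 1 - ξ i ω) P :=
    hind.comp (fun _ y => 1 - y) fun _ => by fun_prop
  filter_upwards [hmem, hlim, ae_eventually_rpow_le_strict hm hind hu hr,
    ae_eventually_rpow_le_strict hm' hind' (fun i => map_one_sub_uniform (hm i) (hu i)) hr]
    with ω h1 h2 h3 h4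
  refine ⟨h1, h2, ⟨8 ^ r, by positivity, ?_⟩, ⟨8 ^ r, by positivity, ?_⟩⟩
  · filter_upwards [h3] with n hn t ht
    refine (hn t ht).trans ?_
    gcongr ?_ * ?_
    refine max_le_max (div_le_div_of_nonneg_right (Finset.sum_le_sum fun i _ => ?_)
      (Nat.cast_nonneg n)) le_rfl
    exact indicator_le_indicator_of_subset Iio_subset_Iic_self (fun _ => zero_le_one) _
  · filter_upwards [h4, eventually_ge_atTop 1] with n hn hn1 t ht
    rw [one_sub_empiricalCDF _ hn1]
    exact hn (1 - t) ⟨by linarith [ht.2], by linarith [ht.1]⟩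

/-! ### Order statistics as quantiles -/

/-- The value of the order statistics at the index given by a natural number `≥ 1`. -/
def orderStatNat (x : ℕ → ℝ) (n m : ℕ) : ℝ :=
  -- Neither the truncated `0 - 1` nor the default `0` matters: for `u ∈ (0, 1)` the index `⌈n u⌉`
  -- lies between `1` and `n`.
  if h : m - 1 < n then orderStat n x ⟨m - 1, h⟩ else 0

/-- The quantile function of the empirical distribution function. -/
def orderQuantile (x : ℕ → ℝ) (n : ℕ) (u : ℝ) : ℝ :=
  orderStatNat x n ⌈(n : ℝ) * u⌉₊

theorem ceil_sub_one_lt {n : ℕ} {u : ℝ} (hn : 1 ≤ n) (hu : u ∈ Ioo (0 : ℝ) 1) :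
    ⌈(n : ℝ) * u⌉₊ - 1 < n := by
  have hn0 : (0 : ℝ) < n := by exact_mod_cast hn
  have : ⌈(n : ℝ) * u⌉₊ ≤ n := Nat.ceil_le.2 (by nlinarith [hu.2])
  omega

theorem orderStat_le_iff (n : ℕ) (x : ℕ → ℝ) (i : Fin n) (t : ℝ) :
    orderStat n x i ≤ t ↔ (i : ℕ) < ((Finset.range n).filter fun j => x j ≤ t).card := by
  classical
  have hmono : Monotone ((fun j : Fin n => x j) ∘ Tuple.sort (fun j : Fin n => x j)) :=
    Tuple.monotone_sort _
  unfold orderStat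
  rw [← Tuple.lt_card_le_iff_apply_le_of_monotone (a := t) (j := i) hmono]
  have : (Finset.univ.filter fun j : Fin n =>
      ((fun j : Fin n => x j) ∘ Tuple.sort (fun j : Fin n => x j)) j ≤ t).card =
      ((Finset.range n).filter fun j => x j ≤ t).card := by
    refine Finset.card_bij (fun j _ => ((Tuple.sort (fun j : Fin n => x j)) j : ℕ)) ?_ ?_ ?_
    · intro j hj
      simp only [Finset.mem_filter, Finset.mem_univ, true_and, Function.comp_apply] at hj
      simp [hj]
    · intro a _ b _ hab
      exact (Tuple.sort (fun j : Fin n => x j)).injective (Fin.ext hab)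
    · intro j hj
      simp only [Finset.mem_filter, Finset.mem_range] at hj
      refine ⟨(Tuple.sort (fun j : Fin n => x j)).symm ⟨j, hj.1⟩, ?_, ?_⟩
      · simp [hj.2]
      · simp
  rw [this]

theorem empiricalCDF_eq_card (x : ℕ → ℝ) (n : ℕ) (t : ℝ) :
    empiricalCDF x n t = (((Finset.range n).filter fun j => x j ≤ t).card : ℝ) / n := by
  unfold empiricalCDF
  congr 1
  rw [Finset.card_filter, Nat.cast_sum]
  refine Finset.sum_congr rfl fun i _ => ?_
  by_cases h : x i ≤ t <;> simp [h, indicator]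

theorem le_empiricalCDF_iff (x : ℕ → ℝ) {n : ℕ} (hn : 1 ≤ n) {u : ℝ} (hu : u ∈ Ioo (0 : ℝ) 1)
    (t : ℝ) : u ≤ empiricalCDF x n t ↔ orderQuantile x n u ≤ t := by
  have hn0 : (0 : ℝ) < n := by exact_mod_cast hn
  have hpos : 0 < ⌈(n : ℝ) * u⌉₊ := Nat.ceil_pos.2 (mul_pos hn0 hu.1)
  unfold orderQuantile orderStatNat
  rw [dif_pos (ceil_sub_one_lt hn hu), orderStat_le_iff, empiricalCDF_eq_card, le_div_iff₀ hn0,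
    mul_comm, ← Nat.ceil_le]
  simp only
  omega

/-- For uniform `u` the rank `⌈n u⌉` is uniform on `1, …, n`. This turns integrals over `u` into
averages over the order statistics, both for the moment bound and for the statistic itself. -/
theorem map_ceil_volume {n : ℕ} (hn : 1 ≤ n) :
    (volume.restrict (Ioo (0 : ℝ) 1)).map (fun u => ⌈(n : ℝ) * u⌉₊) =
      ∑ i : Fin n, (n : ℝ≥0∞)⁻¹ • Measure.dirac ((i : ℕ) + 1) := by
  have hn0 : (0 : ℝ) < n := by exact_mod_cast hn
  have hmeas : Measurable fun u : ℝ => ⌈(n : ℝ) * u⌉₊ := Nat.measurable_ceil.comp (by fun_prop)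
  refine Measure.ext_of_singleton fun m => ?_
  rw [Measure.map_apply hmeas (measurableSet_singleton m), restrict_Ioo_eq_restrict_Ioc,
    Measure.restrict_apply (hmeas (measurableSet_singleton m)), Measure.finsetSum_apply]
  simp only [Measure.smul_apply, smul_eq_mul, Measure.dirac_apply, indicator_apply,
    mem_singleton_iff, Pi.one_apply]
  have hcell : ∀ u : ℝ, 0 < u → (⌈(n : ℝ) * u⌉₊ = m ↔
      m ≠ 0 ∧ ((m : ℝ) - 1) / n < u ∧ u ≤ (m : ℝ) / n) := by
    intro u hu
    have hpos : 0 < ⌈(n : ℝ) * u⌉₊ := Nat.ceil_pos.2 (mul_pos hn0 hu)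
    by_cases hm : m = 0
    · simp only [hm, ne_eq, not_true_eq_false, false_and, iff_false]; omega
    · rw [Nat.ceil_eq_iff hm, div_lt_iff₀ hn0, le_div_iff₀ hn0, Nat.cast_pred (by omega),
        mul_comm u]
      simp [hm]
  by_cases hm : 1 ≤ m ∧ m ≤ n
  · have h1 : (fun u : ℝ => ⌈(n : ℝ) * u⌉₊) ⁻¹' {m} ∩ Ioc 0 1 =
        Ioc (((m : ℝ) - 1) / n) ((m : ℝ) / n) := by
      have hm1 : (1 : ℝ) ≤ m := by exact_mod_cast hm.1
      have hmn : (m : ℝ) ≤ n := by exact_mod_cast hm.2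
      ext u
      simp only [mem_inter_iff, mem_preimage, mem_singleton_iff, mem_Ioc]
      constructor
      · rintro ⟨h, h0, _⟩
        exact ((hcell u h0).1 h).2
      · rintro ⟨h2, h3⟩
        have h0 : 0 < u := lt_of_le_of_lt (div_nonneg (by linarith) hn0.le) h2
        exact ⟨(hcell u h0).2 ⟨by omega, h2, h3⟩, h0, h3.trans ((div_le_one hn0).2 hmn)⟩
    rw [h1, Real.volume_Ioc, Finset.sum_eq_single (⟨m - 1, by omega⟩ : Fin n)]
    · rw [if_pos (by simp only; omega), mul_one, ← sub_div, sub_sub_cancel, one_div,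
        ENNReal.ofReal_inv_of_pos hn0, ENNReal.ofReal_natCast]
    · intro i _ hi
      rw [if_neg, mul_zero]
      intro h
      exact hi (Fin.ext (by simp only; omega))
    · simp
  · have h1 : (fun u : ℝ => ⌈(n : ℝ) * u⌉₊) ⁻¹' {m} ∩ Ioc 0 1 = ∅ := by
      ext u
      simp only [mem_inter_iff, mem_preimage, mem_singleton_iff, mem_Ioc, mem_empty_iff_false,
        iff_false]
      rintro ⟨h, h0, hu1⟩
      refine hm ⟨Nat.one_le_iff_ne_zero.2 ((hcell u h0).1 h).1, ?_⟩
      rw [← h]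
      exact Nat.ceil_le.2 (by nlinarith)
    rw [h1, measure_empty]
    symm
    refine Finset.sum_eq_zero fun i _ => ?_
    rw [if_neg, mul_zero]
    intro h
    exact hm ⟨by omega, by have := i.2; omega⟩

theorem orderStatNat_succ (x : ℕ → ℝ) (n : ℕ) (i : Fin n) :
    orderStatNat x n ((i : ℕ) + 1) = orderStat n x i := by
  simp [orderStatNat]

theorem sum_orderStat {E : Type*} [AddCommMonoid E] (φ : ℝ → E) (x : ℕ → ℝ) (n : ℕ) :
    ∑ i : Fin n, φ (orderStat n x i) = ∑ i ∈ Finset.range n, φ (x i) := by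
  rw [← Fin.sum_univ_eq_sum_range (fun i => φ (x i)) n]
  exact Equiv.sum_comp (Tuple.sort fun j : Fin n => x j) (fun j : Fin n => φ (x j))

theorem lintegral_orderQuantile (φ : ℝ → ℝ≥0∞) (x : ℕ → ℝ) {n : ℕ} (hn : 1 ≤ n) :
    ∫⁻ u in Ioo (0 : ℝ) 1, φ (orderQuantile x n u) =
      (n : ℝ≥0∞)⁻¹ * ∑ i ∈ Finset.range n, φ (x i) := by
  have hmeas : Measurable fun u : ℝ => ⌈(n : ℝ) * u⌉₊ := Nat.measurable_ceil.comp (by fun_prop)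
  have h : ∫⁻ m, φ (orderStatNat x n m) ∂((volume.restrict (Ioo (0 : ℝ) 1)).map
      (fun u => ⌈(n : ℝ) * u⌉₊)) = ∫⁻ u in Ioo (0 : ℝ) 1, φ (orderQuantile x n u) :=
    lintegral_map measurable_from_nat hmeas
  rw [← h, map_ceil_volume hn, lintegral_finsetSum_measure]
  simp only [lintegral_smul_measure, lintegral_dirac, orderStatNat_succ, smul_eq_mul]
  rw [← Finset.mul_sum, sum_orderStat]

theorem orderStatSum_eq_integral (g : ℝ → ℝ) (c : ℕ → ℕ → ℝ) {x : ℕ → ℝ}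
    (hx : ∀ i, x i ∈ Ioo (0 : ℝ) 1) {n : ℕ} (hn : 1 ≤ n) :
    orderStatSum g c n x = ∫ u in Ioo (0 : ℝ) 1,
      (Ioo (0 : ℝ) 1).indicator g (orderQuantile x n u) * scoreFun c n u := by
  have hmeas : Measurable fun u : ℝ => ⌈(n : ℝ) * u⌉₊ := Nat.measurable_ceil.comp (by fun_prop)
  have h : ∫ m, (Ioo (0 : ℝ) 1).indicator g (orderStatNat x n m) * c n m
      ∂((volume.restrict (Ioo (0 : ℝ) 1)).map (fun u => ⌈(n : ℝ) * u⌉₊)) =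
      ∫ u in Ioo (0 : ℝ) 1,
        (Ioo (0 : ℝ) 1).indicator g (orderQuantile x n u) * scoreFun c n u := by
    rw [integral_map hmeas.aemeasurable measurable_from_nat.aestronglyMeasurable]
    refine setIntegral_congr_fun measurableSet_Ioo fun u hu => ?_
    simp only [scoreFun, if_neg (not_le.2 hu.1)]
    rfl
  rw [← h, map_ceil_volume hn, integral_finsetSum_measure]
  · simp only [integral_smul_measure, integral_dirac, orderStatNat_succ, smul_eq_mul]
    rw [← Finset.mul_sum]
    unfold orderStatSum
    simp only [ENNReal.toReal_inv, ENNReal.toReal_natCast, one_div]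
    congr 1
    refine Finset.sum_congr rfl fun i _ => ?_
    rw [indicator_of_mem]
    exact hx _
  · intro i _
    refine Integrable.smul_measure ?_ (by simp; omega)
    exact integrable_dirac (by finiteness)

theorem UniformSample.quantileApprox_order {x : ℕ → ℝ} {r β : ℝ} (h : UniformSample x r) {A : ℝ}
    (hA : Tendsto (fun n : ℕ => (∑ i ∈ Finset.range n, (endWeight β (x i)).toReal) / n) atTop
      (𝓝 A)) :
    QuantileApprox (empiricalCDF x) (orderQuantile x) r β where
  le_iff n hn u hu t := le_empiricalCDF_iff x hn hu t
  tendsto := h.tendsto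
  left_tail := h.left_tail
  right_tail := h.right_tail
  moment := by
    refine ⟨ENNReal.ofReal (A + 1), ENNReal.ofReal_ne_top, ?_⟩
    filter_upwards [hA.eventually_lt_const (lt_add_one A), eventually_ge_atTop 1] with n h1 hn
    have hn0 : (0 : ℝ) < n := by exact_mod_cast hn
    rw [lintegral_orderQuantile _ x hn]
    refine le_trans (le_of_eq ?_) (ENNReal.ofReal_le_ofReal h1.le)
    rw [ENNReal.ofReal_div_of_pos hn0, ENNReal.ofReal_natCast, ENNReal.div_eq_inv_mul,
      ENNReal.ofReal_sum_of_nonneg fun _ _ => ENNReal.toReal_nonneg]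
    simp_rw [ENNReal.ofReal_toReal (endWeight_ne_top _ _)]

/-! ### Quantile functions of probability measures -/

/-- The limits at `±∞` make the infimum that of a nonempty set bounded below; right continuity makes
it attained. -/
theorem le_cdf_iff_leftInverse_le (κ : Measure ℝ) {u : ℝ} (hu : u ∈ Ioo (0 : ℝ) 1) (t : ℝ) :
    u ≤ cdf κ t ↔ leftInverse (cdf κ) u ≤ t := by
  have hne : {t | u ≤ cdf κ t}.Nonempty := by
    obtain ⟨s, hs⟩ := ((tendsto_cdf_atTop κ).eventually_const_lt hu.2).exists
    exact ⟨s, hs.le⟩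
  have hbdd : BddBelow {t | u ≤ cdf κ t} := by
    obtain ⟨s, hs⟩ := ((tendsto_cdf_atBot κ).eventually_lt_const hu.1).exists
    refine ⟨s, fun t ht => ?_⟩
    by_contra hcon
    exact absurd (ht.trans (monotone_cdf κ (not_le.1 hcon).le)) (not_le.2 hs)
  constructor
  · intro h
    exact csInf_le hbdd h
  · intro h
    have hright : Tendsto (cdf κ) (𝓝[>] t) (𝓝 (cdf κ t)) :=
      ((cdf κ).right_continuous t).mono Ioi_subset_Ici_self
    refine ge_of_tendsto hright ?_
    filter_upwards [self_mem_nhdsWithin] with s hs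
    obtain ⟨v, hv, hvs⟩ := exists_lt_of_csInf_lt hne (lt_of_le_of_lt h hs)
    exact le_trans hv (monotone_cdf κ hvs.le)

theorem aemeasurable_leftInverse_cdf (κ : Measure ℝ) :
    AEMeasurable (leftInverse (cdf κ)) (volume.restrict (Ioo (0 : ℝ) 1)) := by
  refine aemeasurable_restrict_of_monotoneOn measurableSet_Ioo fun u hu v hv huv => ?_
  exact (le_cdf_iff_leftInverse_le κ hu _).1
    (huv.trans ((le_cdf_iff_leftInverse_le κ hv _).2 le_rfl))

theorem map_leftInverse_cdf (κ : Measure ℝ) [IsProbabilityMeasure κ] :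
    (volume.restrict (Ioo (0 : ℝ) 1)).map (leftInverse (cdf κ)) = κ := by
  have hfin : IsFiniteMeasure (volume.restrict (Ioo (0 : ℝ) 1)) := ⟨by simp⟩
  refine Measure.ext_of_Iic _ _ fun t => ?_
  have hm := aemeasurable_leftInverse_cdf κ
  rw [Measure.map_apply_of_aemeasurable hm measurableSet_Iic]
  have h1 : (volume.restrict (Ioo (0 : ℝ) 1)) (leftInverse (cdf κ) ⁻¹' Iic t) =
      (volume.restrict (Ioo (0 : ℝ) 1)) (Iic (cdf κ t)) := by
    refine measure_congr ?_
    filter_upwards [ae_restrict_mem measurableSet_Ioo] with u hu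
    exact propext (le_cdf_iff_leftInverse_le κ hu t).symm
  rw [h1, restrict_Ioo_eq_restrict_Ioc, Measure.restrict_apply measurableSet_Iic, inter_comm,
    Ioc_inter_Iic, min_eq_right (cdf_le_one κ t), Real.volume_Ioc, sub_zero, ofReal_cdf]

/-! ### The kernel as a probability measure -/

/-- The probability measure with density `k`. -/
def kernelMeasure (k : ℝ → ℝ) : Measure ℝ := volume.withDensity fun z => ENNReal.ofReal (k z)

namespace KernelAssumption

variable {k : ℝ → ℝ}

theorem isProbabilityMeasure (hk : KernelAssumption k) :
    IsProbabilityMeasure (kernelMeasure k) := by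
  refine ⟨?_⟩
  rw [kernelMeasure, withDensity_apply _ MeasurableSet.univ, Measure.restrict_univ,
    ← ofReal_integral_eq_lintegral_ofReal hk.integrable (Eventually.of_forall hk.nonneg),
    hk.integral_eq_one, ENNReal.ofReal_one]

theorem ofReal_kernelCDF (hk : KernelAssumption k) (t : ℝ) :
    ENNReal.ofReal (kernelCDF k t) = kernelMeasure k (Iic t) := by
  rw [kernelMeasure, withDensity_apply _ measurableSet_Iic, kernelCDF,
    ofReal_integral_eq_lintegral_ofReal hk.integrable.integrableOn
      (Eventually.of_forall hk.nonneg)]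

theorem kernelCDF_nonneg (hk : KernelAssumption k) (t : ℝ) : 0 ≤ kernelCDF k t :=
  setIntegral_nonneg measurableSet_Iic fun x _ => hk.nonneg x

theorem kernelCDF_eq_cdf (hk : KernelAssumption k) (t : ℝ) :
    kernelCDF k t = cdf (kernelMeasure k) t := by
  have := hk.isProbabilityMeasure
  rw [cdf_eq_real, Measure.real, ← hk.ofReal_kernelCDF,
    ENNReal.toReal_ofReal (hk.kernelCDF_nonneg t)]

theorem one_sub_kernelCDF (hk : KernelAssumption k) (t : ℝ) :
    1 - kernelCDF k t = ∫ x in Ioi t, k x := by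
  have h := integral_add_compl (measurableSet_Iic (a := t)) hk.integrable
  rw [hk.integral_eq_one, compl_Iic] at h
  unfold kernelCDF
  linarith

theorem not_mul_ae_eq_zero (hk : KernelAssumption k) :
    ¬(fun x => x * k x) =ᵐ[volume] 0 := by
  intro h
  have h0 : k =ᵐ[volume] 0 := by
    have hne : ∀ᵐ x : ℝ, x ≠ 0 := by simp [ae_iff, measure_singleton]
    filter_upwards [h, hne] with x hx hx0
    exact (mul_eq_zero.1 hx).resolve_left hx0
  have := hk.integral_eq_one
  rw [integral_congr_ae h0] at this
  simp at this

/-- Without mass on the left of `0`, `x * k x` would be almost everywhere nonnegative with zero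
integral, forcing `k = 0` almost everywhere. With its mirror image below, this transfers tail bounds
from the empirical distribution to the kernel estimator. -/
theorem kernelCDF_zero_pos (hk : KernelAssumption k) : 0 < kernelCDF k 0 := by
  refine (hk.kernelCDF_nonneg 0).lt_of_ne' fun h => ?_
  have h1 : ∀ᵐ x, x ∈ Iic (0 : ℝ) → k x = 0 := by
    have := (setIntegral_eq_zero_iff_of_nonneg_ae (Eventually.of_forall hk.nonneg)
      hk.integrable.integrableOn).1 h
    exact (ae_restrict_iff' measurableSet_Iic).1 this
  refine hk.not_mul_ae_eq_zero ((integral_eq_zero_iff_of_nonneg_ae ?_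
    hk.integrable_mean).1 hk.mean_zero)
  filter_upwards [h1] with x hx
  rcases le_total x 0 with h0 | h0
  · simp [hx h0]
  · exact mul_nonneg h0 (hk.nonneg x)

theorem kernelCDF_zero_lt_one (hk : KernelAssumption k) : kernelCDF k 0 < 1 := by
  have h0 : 0 ≤ ∫ x in Ioi 0, k x := setIntegral_nonneg measurableSet_Ioi fun x _ => hk.nonneg x
  rw [← sub_pos, one_sub_kernelCDF hk]
  refine h0.lt_of_ne' fun h => ?_
  have h1 : ∀ᵐ x, x ∈ Ioi (0 : ℝ) → k x = 0 := by
    have := (setIntegral_eq_zero_iff_of_nonneg_ae (Eventually.of_forall hk.nonneg)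
      hk.integrable.integrableOn).1 h
    exact (ae_restrict_iff' measurableSet_Ioi).1 this
  have hneg : (fun x => -(x * k x)) =ᵐ[volume] 0 := by
    refine (integral_eq_zero_iff_of_nonneg_ae ?_ hk.integrable_mean.neg).1 ?_
    · filter_upwards [h1] with x hx
      rcases le_or_gt x 0 with h0 | h0
      · simp only [Pi.zero_apply, Pi.neg_apply, Left.nonneg_neg_iff]
        exact mul_nonpos_of_nonpos_of_nonneg h0 (hk.nonneg x)
      · simp [hx h0]
    · change ∫ x, -(x * k x) = 0
      rw [integral_neg, hk.mean_zero, neg_zero]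
  refine hk.not_mul_ae_eq_zero ?_
  filter_upwards [hneg] with x hx
  simpa using hx

end KernelAssumption

/-! ### Smoothing of samples and functions by the scaled kernel. -/

theorem lintegral_kernelMeasure_le {k : ℝ → ℝ} {C : ℝ} (hC : ∀ x, k x ≤ C)
    (φ : ℝ → ℝ≥0∞) : ∫⁻ z, φ z ∂(kernelMeasure k) ≤ ENNReal.ofReal C * ∫⁻ z, φ z := by
  have hle : kernelMeasure k ≤ ENNReal.ofReal C • volume := by
    rw [← withDensity_const]
    exact withDensity_mono (Eventually.of_forall fun x => ENNReal.ofReal_le_ofReal (hC x))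
  refine (lintegral_mono' hle le_rfl).trans ?_
  rw [lintegral_smul_measure, smul_eq_mul]

theorem setIntegral_Iic_comp_sub_div (k : ℝ → ℝ) {b : ℝ} (hb : 0 < b) (x t : ℝ) :
    ∫ s in Iic t, k ((s - x) / b) = b * kernelCDF k ((t - x) / b) := by
  have h1 : ∀ s, (Iic t).indicator (fun s => k ((s - x) / b)) s =
      (Iic ((t - x) / b)).indicator k ((s - x) / b) := by
    intro s
    by_cases hs : s ≤ t
    · rw [indicator_of_mem (show s ∈ Iic t from hs), indicator_of_mem]
      exact div_le_div_of_nonneg_right (by linarith) hb.le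
    · rw [indicator_of_notMem (show s ∉ Iic t from hs), indicator_of_notMem]
      simp only [mem_Iic, not_le]
      exact div_lt_div_of_pos_right (by linarith [not_le.1 hs]) hb
  rw [← integral_indicator measurableSet_Iic, kernelCDF, ← integral_indicator measurableSet_Iic]
  simp_rw [h1]
  rw [integral_sub_right_eq_self (fun s => (Iic ((t - x) / b)).indicator k (s / b)) x,
    Measure.integral_comp_div, abs_of_pos hb, smul_eq_mul]

theorem kernelEstimator_eq (k : ℝ → ℝ) {b : ℝ} (hb : 0 < b) (n : ℕ) (x : ℕ → ℝ) (t : ℝ) :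
    kernelEstimator k b n x t = (∑ i ∈ Finset.range n, kernelCDF k ((t - x i) / b)) / n := by
  unfold kernelEstimator
  simp_rw [setIntegral_Iic_comp_sub_div k hb]
  rw [← Finset.mul_sum, ← mul_assoc, one_div, mul_inv, mul_assoc (n : ℝ)⁻¹,
    inv_mul_cancel₀ hb.ne', mul_one]
  ring

/-- The probability measure with distribution function `kernelEstimator k b n x`. -/
def smoothedMeasure (k : ℝ → ℝ) (b : ℝ) (n : ℕ) (x : ℕ → ℝ) : Measure ℝ :=
  (n : ℝ≥0∞)⁻¹ • ∑ i ∈ Finset.range n, (kernelMeasure k).map fun z => x i + b * z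

theorem isProbabilityMeasure_smoothedMeasure {k : ℝ → ℝ} (hk : KernelAssumption k) (b : ℝ) {n : ℕ}
    (hn : 1 ≤ n) (x : ℕ → ℝ) : IsProbabilityMeasure (smoothedMeasure k b n x) := by
  have := hk.isProbabilityMeasure
  refine ⟨?_⟩
  rw [smoothedMeasure, Measure.smul_apply, Measure.finsetSum_apply]
  have h : ∀ i, ((kernelMeasure k).map fun z => x i + b * z) univ = 1 := fun i => by
    rw [Measure.map_apply (by fun_prop) MeasurableSet.univ, preimage_univ, measure_univ]
  simp only [h, Finset.sum_const, Finset.card_range, nsmul_eq_mul, mul_one, smul_eq_mul]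
  exact ENNReal.inv_mul_cancel (by simp; omega) (by simp)

theorem cdf_smoothedMeasure {k : ℝ → ℝ} (hk : KernelAssumption k) {b : ℝ} (hb : 0 < b) {n : ℕ}
    (hn : 1 ≤ n) (x : ℕ → ℝ) :
    ⇑(cdf (smoothedMeasure k b n x)) = kernelEstimator k b n x := by
  have := isProbabilityMeasure_smoothedMeasure hk b hn x
  have hn0 : (0 : ℝ) < n := by exact_mod_cast hn
  ext t
  have hpos : 0 ≤ kernelEstimator k b n x t := by
    rw [kernelEstimator_eq k hb]
    exact div_nonneg (Finset.sum_nonneg fun i _ => hk.kernelCDF_nonneg _) hn0.le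
  rw [cdf_eq_real, Measure.real, ← ENNReal.toReal_ofReal hpos]
  congr 1
  rw [kernelEstimator_eq k hb, ENNReal.ofReal_div_of_pos hn0, ENNReal.ofReal_natCast,
    ENNReal.ofReal_sum_of_nonneg fun i _ => hk.kernelCDF_nonneg _, smoothedMeasure,
    Measure.smul_apply, Measure.finsetSum_apply, smul_eq_mul, ENNReal.div_eq_inv_mul]
  congr 1
  refine Finset.sum_congr rfl fun i _ => ?_
  rw [hk.ofReal_kernelCDF, Measure.map_apply (by fun_prop) measurableSet_Iic]
  congr 1
  ext z
  simp only [mem_preimage, mem_Iic]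
  rw [le_div_iff₀ hb]
  constructor <;> intro h <;> linarith

/-- The convolution of `φ` with the kernel at bandwidth `b`. -/
def smoothing (k : ℝ → ℝ) (b : ℝ) (φ : ℝ → ℝ≥0∞) (y : ℝ) : ℝ≥0∞ :=
  ∫⁻ z, φ (y + b * z) ∂(kernelMeasure k)

/-- The quantile function pushes the uniform law to the smoothed empirical measure; the smoothing is
then moved from the measure to `φ`. -/
theorem lintegral_leftInverse_kernelEstimator {k : ℝ → ℝ} (hk : KernelAssumption k) {b : ℝ}
    (hb : 0 < b) {n : ℕ} (hn : 1 ≤ n) (x : ℕ → ℝ) {φ : ℝ → ℝ≥0∞} (hφ : Measurable φ) :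
    ∫⁻ u in Ioo (0 : ℝ) 1, φ (leftInverse (kernelEstimator k b n x) u) =
      (n : ℝ≥0∞)⁻¹ * ∑ i ∈ Finset.range n, smoothing k b φ (x i) := by
  have := isProbabilityMeasure_smoothedMeasure hk b hn x
  rw [← cdf_smoothedMeasure hk hb hn, ← lintegral_map' hφ.aemeasurable
    (aemeasurable_leftInverse_cdf _), map_leftInverse_cdf, smoothedMeasure, lintegral_smul_measure,
    lintegral_finsetSum_measure, smul_eq_mul]
  congr 1
  refine Finset.sum_congr rfl fun i _ => ?_
  rw [lintegral_map hφ (by fun_prop)]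
  rfl

theorem measurable_smoothing {k : ℝ → ℝ} (hk : KernelAssumption k) (b : ℝ) {φ : ℝ → ℝ≥0∞}
    (hφ : Measurable φ) : Measurable (smoothing k b φ) := by
  have := hk.isProbabilityMeasure
  have : Measurable fun q : ℝ × ℝ => φ (q.1 + b * q.2) := hφ.comp (by fun_prop)
  exact this.lintegral_prod_right'

theorem lintegral_smoothing_le {k : ℝ → ℝ} (hk : KernelAssumption k) (b : ℝ) {φ : ℝ → ℝ≥0∞}
    (hφ : Measurable φ) : ∫⁻ y, smoothing k b φ y ≤ ∫⁻ t, φ t := by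
  have := hk.isProbabilityMeasure
  unfold smoothing
  have hm : Measurable fun q : ℝ × ℝ => φ (q.1 + b * q.2) := hφ.comp (by fun_prop)
  rw [lintegral_lintegral_swap hm.aemeasurable]
  simp_rw [lintegral_add_right_eq_self φ]
  simp

/-- Truncation of `φ` at `L = b ^ (-1 / p)`: the excess is at most `φ ^ p * L ^ (1 - p)`, and
boundedness of the kernel with a change of scale costs `C / b`. This `L` balances the two terms, as
`b⁻¹ * L ^ (1 - p) = L`. -/
theorem smoothing_le {k : ℝ → ℝ} (hk : KernelAssumption k) {C : ℝ} (hC : ∀ x, k x ≤ C) {b : ℝ}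
    (hb : 0 < b) {p : ℝ} (hp : 1 < p) {φ : ℝ → ℝ≥0∞} (hφ : Measurable φ) (y : ℝ) :
    smoothing k b φ y ≤
      ENNReal.ofReal (b ^ (-(1 / p))) * (1 + ENNReal.ofReal C * ∫⁻ t, φ t ^ p) := by
  have := hk.isProbabilityMeasure
  set L := ENNReal.ofReal (b ^ (-(1 / p))) with hL
  have hbp : 0 < b ^ (-(1 / p)) := Real.rpow_pos_of_pos hb _
  have hL0 : L ≠ 0 := (ENNReal.ofReal_pos.2 hbp).ne'
  have hLt : L ≠ ∞ := ENNReal.ofReal_ne_top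
  have hscale : ∫⁻ z, φ (y + b * z) ^ p = ENNReal.ofReal b⁻¹ * ∫⁻ t, φ t ^ p := by
    have hm : Measurable fun t => φ (y + t) ^ p := (hφ.comp (by fun_prop)).pow_const p
    have h1 := lintegral_map (μ := volume) hm (measurable_const_mul b)
    rw [Real.map_volume_mul_left hb.ne', lintegral_smul_measure, abs_of_pos (inv_pos.2 hb),
      lintegral_add_left_eq_self (fun t => φ t ^ p) y, smul_eq_mul] at h1
    exact h1.symm
  have hpow : ENNReal.ofReal b⁻¹ * L ^ (1 - p) = L := by
    rw [hL, ENNReal.ofReal_rpow_of_pos hbp, ← ENNReal.ofReal_mul (by positivity),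
      ← Real.rpow_mul hb.le, ← Real.rpow_neg_one, ← Real.rpow_add hb]
    congr 2
    field_simp
    ring
  have hm : Measurable fun z => φ (y + b * z) ^ p := (hφ.comp (by fun_prop)).pow_const p
  calc smoothing k b φ y
      ≤ ∫⁻ z, (L + φ (y + b * z) ^ p * L ^ (1 - p)) ∂(kernelMeasure k) := by
        refine lintegral_mono fun z => ?_
        refine (ennreal_le_min_add_rpow hp hL0 hLt _).trans ?_
        gcongr
        exact min_le_right _ _
    _ = L + (∫⁻ z, φ (y + b * z) ^ p ∂(kernelMeasure k)) * L ^ (1 - p) := by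
        rw [lintegral_add_left measurable_const, lintegral_const, measure_univ, mul_one,
          lintegral_mul_const'' _ hm.aemeasurable]
    _ ≤ L + (ENNReal.ofReal C * (ENNReal.ofReal b⁻¹ * ∫⁻ t, φ t ^ p)) * L ^ (1 - p) := by
        gcongr
        rw [← hscale]
        exact lintegral_kernelMeasure_le hC fun z => φ (y + b * z) ^ p
    _ = L + (ENNReal.ofReal b⁻¹ * L ^ (1 - p)) * (ENNReal.ofReal C * ∫⁻ t, φ t ^ p) := by ring
    _ = _ := by rw [hpow]; ring

/-! ### The kernel estimator of a uniform sample -/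

theorem BandwidthAssumption.tendsto_div_atTop {b : ℕ → ℝ} (hb : BandwidthAssumption b) {c : ℝ}
    (hc : 0 < c) : Tendsto (fun n => c / b n) atTop atTop := by
  have h : Tendsto b atTop (𝓝[>] 0) := tendsto_nhdsWithin_iff.2 ⟨hb.tendsto_zero,
    (eventually_ge_atTop 1).mono fun n hn => hb.pos n hn⟩
  exact (h.inv_tendsto_nhdsGT_zero.const_mul_atTop hc).congr fun n => (div_eq_mul_inv _ _).symm

namespace KernelAssumption

variable {k : ℝ → ℝ}

theorem kernelCDF_mono (hk : KernelAssumption k) : Monotone (kernelCDF k) := fun s t h => by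
  rw [hk.kernelCDF_eq_cdf, hk.kernelCDF_eq_cdf]
  exact monotone_cdf _ h

theorem kernelCDF_le_one (hk : KernelAssumption k) (t : ℝ) : kernelCDF k t ≤ 1 := by
  rw [hk.kernelCDF_eq_cdf]
  exact cdf_le_one _ _

theorem tendsto_kernelCDF_atTop (hk : KernelAssumption k) :
    Tendsto (kernelCDF k) atTop (𝓝 1) :=
  (tendsto_cdf_atTop (kernelMeasure k)).congr fun t => (hk.kernelCDF_eq_cdf t).symm

theorem tendsto_kernelCDF_atBot (hk : KernelAssumption k) :
    Tendsto (kernelCDF k) atBot (𝓝 0) :=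
  (tendsto_cdf_atBot (kernelMeasure k)).congr fun t => (hk.kernelCDF_eq_cdf t).symm

/-- Each observation at most `s` contributes at least `K((t - s) / b)`. The choice `s = t` gives the
factor `K(0)` for the tails; a fixed `s < t` gives a factor tending to `1`. -/
theorem mul_empiricalCDF_le_kernelEstimator (hk : KernelAssumption k) {b : ℝ} (hb : 0 < b) (n : ℕ)
    (x : ℕ → ℝ) (s t : ℝ) :
    kernelCDF k ((t - s) / b) * empiricalCDF x n s ≤ kernelEstimator k b n x t := by
  rw [kernelEstimator_eq k hb, empiricalCDF, ← mul_div_assoc, Finset.mul_sum]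
  refine div_le_div_of_nonneg_right (Finset.sum_le_sum fun i _ => ?_) (Nat.cast_nonneg n)
  by_cases h : x i ≤ s
  · rw [indicator_of_mem (show x i ∈ Iic s from h), Pi.one_apply, mul_one]
    exact hk.kernelCDF_mono (div_le_div_of_nonneg_right (by linarith) hb.le)
  · rw [indicator_of_notMem (show x i ∉ Iic s from h), mul_zero]
    exact hk.kernelCDF_nonneg _

theorem kernelEstimator_le (hk : KernelAssumption k) {b : ℝ} (hb : 0 < b) {n : ℕ} (hn : 1 ≤ n)
    (x : ℕ → ℝ) (s t : ℝ) :
    kernelEstimator k b n x t ≤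
      empiricalCDF x n s + kernelCDF k ((t - s) / b) * (1 - empiricalCDF x n s) := by
  have hn0 : (0 : ℝ) < n := by exact_mod_cast hn
  set K := kernelCDF k ((t - s) / b) with hK
  have hterm : ∀ i ∈ Finset.range n, kernelCDF k ((t - x i) / b) ≤
      K + (1 - K) * (Iic s).indicator (1 : ℝ → ℝ) (x i) := by
    intro i _
    by_cases h : x i ≤ s
    · rw [indicator_of_mem (show x i ∈ Iic s from h), Pi.one_apply, mul_one,
        add_sub_cancel]
      exact hk.kernelCDF_le_one _
    · rw [indicator_of_notMem (show x i ∉ Iic s from h), mul_zero, add_zero]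
      exact hk.kernelCDF_mono (div_le_div_of_nonneg_right (by linarith [not_le.1 h]) hb.le)
  rw [kernelEstimator_eq k hb, empiricalCDF, div_le_iff₀ hn0]
  refine (Finset.sum_le_sum hterm).trans (le_of_eq ?_)
  rw [Finset.sum_add_distrib, ← Finset.mul_sum]
  simp only [Finset.sum_const, Finset.card_range, nsmul_eq_mul]
  field_simp
  ring

end KernelAssumption

theorem UniformSample.tendsto_kernelEstimator {x : ℕ → ℝ} {r : ℝ} (h : UniformSample x r)
    {k : ℝ → ℝ} (hk : KernelAssumption k) {b : ℕ → ℝ} (hb : BandwidthAssumption b) {q : ℝ}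
    (hq : q ∈ Ioo (0 : ℝ) 1) :
    Tendsto (fun n => kernelEstimator k (b n) n x q) atTop (𝓝 q) := by
  rw [tendsto_order]
  constructor
  · intro a ha
    obtain ⟨s, hs1, hs2⟩ := exists_rat_btwn (max_lt ha hq.1)
    have hs : (s : ℝ) ∈ Ioo (0 : ℝ) 1 := ⟨(le_max_right _ _).trans_lt hs1, hs2.trans hq.2⟩
    have hlim : Tendsto (fun n => kernelCDF k ((q - s) / b n) * empiricalCDF x n s) atTop
        (𝓝 (1 * s)) :=
      (hk.tendsto_kernelCDF_atTop.comp (hb.tendsto_div_atTop (sub_pos.2 hs2))).mul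
        (h.tendsto s hs)
    rw [one_mul] at hlim
    filter_upwards [hlim.eventually_const_lt ((le_max_left _ _).trans_lt hs1),
      eventually_ge_atTop 1] with n hn hn1
    exact hn.trans_le (hk.mul_empiricalCDF_le_kernelEstimator (hb.pos n hn1) n x s q)
  · intro a ha
    obtain ⟨s, hs1, hs2⟩ := exists_rat_btwn (lt_min ha hq.2)
    have hs : (s : ℝ) ∈ Ioo (0 : ℝ) 1 := ⟨hq.1.trans hs1, hs2.trans_le (min_le_right _ _)⟩
    have hbot : Tendsto (fun n => (q - s) / b n) atTop atBot := by
      refine (tendsto_neg_atTop_atBot.comp (hb.tendsto_div_atTop (sub_pos.2 hs1))).congr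
        fun n => ?_
      simp only [Function.comp_apply]
      ring
    have hlim : Tendsto (fun n => empiricalCDF x n s +
        kernelCDF k ((q - s) / b n) * (1 - empiricalCDF x n s)) atTop
        (𝓝 (s + 0 * (1 - s))) :=
      (h.tendsto s hs).add ((hk.tendsto_kernelCDF_atBot.comp hbot).mul
        ((h.tendsto s hs).const_sub 1))
    rw [zero_mul, add_zero] at hlim
    filter_upwards [hlim.eventually_lt_const (hs2.trans_le (min_le_left _ _)),
      eventually_ge_atTop 1] with n hn hn1
    exact (hk.kernelEstimator_le (hb.pos n hn1) hn1 x s q).trans_lt hn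

theorem max_le_div_mul_max {e F K v : ℝ} (hK : 0 < K) (hK1 : K ≤ 1) (h : K * e ≤ F) (hv : 0 ≤ v) :
    max e v ≤ 1 / K * max F v := by
  rw [one_div, inv_mul_eq_div, le_div_iff₀ hK, max_mul_of_nonneg _ _ hK.le]
  refine max_le_max (by linarith) ?_
  nlinarith

theorem UniformSample.quantileApprox_kernel {x : ℕ → ℝ} {r β : ℝ} (h : UniformSample x r)
    {k : ℝ → ℝ} (hk : KernelAssumption k) {b : ℕ → ℝ} (hb : BandwidthAssumption b) {A : ℝ≥0∞}
    (hA : A ≠ ∞) (hmom : ∀ᶠ n : ℕ in atTop,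
      (n : ℝ≥0∞)⁻¹ * ∑ i ∈ Finset.range n, smoothing k (b n) (endWeight β) (x i) ≤ A) :
    QuantileApprox (fun n => kernelEstimator k (b n) n x)
      (fun n => leftInverse (kernelEstimator k (b n) n x)) r β where
  le_iff n hn u hu t := by
    rw [← cdf_smoothedMeasure hk (hb.pos n hn) hn]
    exact le_cdf_iff_leftInverse_le _ hu t
  tendsto q hq := h.tendsto_kernelEstimator hk hb hq
  left_tail := by
    obtain ⟨C, hC, hCn⟩ := h.left_tail
    have hK := hk.kernelCDF_zero_pos
    refine ⟨C * (1 / kernelCDF k 0), by positivity, ?_⟩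
    filter_upwards [hCn, eventually_ge_atTop 1] with n hn hn1 t ht
    refine (hn t ht).trans ?_
    rw [mul_assoc]
    gcongr
    refine max_le_div_mul_max hK (hk.kernelCDF_le_one 0) ?_ (by positivity)
    simpa using hk.mul_empiricalCDF_le_kernelEstimator (hb.pos n hn1) n x t t
  right_tail := by
    obtain ⟨C, hC, hCn⟩ := h.right_tail
    have hK := sub_pos.2 hk.kernelCDF_zero_lt_one
    refine ⟨C * (1 / (1 - kernelCDF k 0)), by positivity, ?_⟩
    filter_upwards [hCn, eventually_ge_atTop 1] with n hn hn1 t ht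
    refine (hn t ht).trans ?_
    rw [mul_assoc]
    gcongr
    refine max_le_div_mul_max hK (by linarith [hk.kernelCDF_nonneg 0]) ?_ (by positivity)
    have := hk.kernelEstimator_le (hb.pos n hn1) hn1 x t t
    rw [sub_self, zero_div] at this
    linarith
  moment := by
    refine ⟨A, hA, ?_⟩
    filter_upwards [hmom, eventually_ge_atTop 1] with n hn hn1
    rw [lintegral_leftInverse_kernelEstimator hk (hb.pos n hn1) hn1 x (measurable_endWeight β)]
    exact hn

/-- The convolved weight is at most of order `b ^ (-1 / p)` for some `p > 1`, so that `n b ≥ 1`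
gives summable exponential bounds for its sample averages. -/
theorem ae_eventually_smoothing_average_le {Ω : Type*} [MeasurableSpace Ω] {P : Measure Ω}
    [IsProbabilityMeasure P] {ξ : ℕ → Ω → ℝ} (hm : ∀ i, Measurable (ξ i)) (hind : iIndepFun ξ P)
    (hu : ∀ i, P.map (ξ i) = volume.restrict (Ioo (0 : ℝ) 1)) {k : ℝ → ℝ}
    (hk : KernelAssumption k) {b : ℕ → ℝ} (hb : BandwidthAssumption b) {β : ℝ} (hβ : 0 ≤ β)
    (hβ1 : β < 1) :
    ∃ A : ℝ≥0∞, A ≠ ∞ ∧ ∀ᵐ ω ∂P, ∀ᶠ n : ℕ in atTop,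
      (n : ℝ≥0∞)⁻¹ * ∑ i ∈ Finset.range n, smoothing k (b n) (endWeight β) (ξ i ω) ≤ A := by
  obtain ⟨C, hC⟩ := hk.bounded
  -- This choice gives both `p > 1` and `β * p < 1`, so the weight has a finite `p`-th moment.
  set p : ℝ := 2 / (1 + β) with hp
  have hp1 : 1 < p := by rw [hp, lt_div_iff₀ (by linarith)]; linarith
  have hp0 : 0 < p := by linarith
  have hβp : β * p < 1 := by
    rw [hp, ← mul_div_assoc, div_lt_one (by linarith)]; linarith
  have hI := lintegral_endWeight_lt_top hβ hβ1
  have hIp := lintegral_endWeight_lt_top (mul_nonneg hβ hp0.le) hβp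
  set E : ℝ≥0∞ := 1 + ENNReal.ofReal C * ∫⁻ t, endWeight β t ^ p with hE
  have hEt : E ≠ ∞ := by
    simp_rw [hE, endWeight_rpow β hp0]
    exact ENNReal.add_ne_top.2
      ⟨ENNReal.one_ne_top, ENNReal.mul_ne_top ENNReal.ofReal_ne_top hIp.ne⟩
  have hE1 : 1 ≤ E.toReal := by
    have : (1 : ℝ≥0∞) ≤ E := le_self_add
    simpa using ENNReal.toReal_mono hEt this
  -- A bound, uniform in `n`, for the mean of the convolved weight; the added `1` makes the
  -- exponential rate positive.
  set i₀ : ℝ := (∫⁻ t, endWeight β t).toReal + 1 with hi₀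
  have hi₀pos : 0 < i₀ := by positivity
  set φ : ℕ → ℝ → ℝ := fun n y => (smoothing k (b n) (endWeight β) y).toReal with hφ
  have hφm : ∀ n, Measurable (φ n) := fun n =>
    (measurable_smoothing hk (b n) (measurable_endWeight β)).ennreal_toReal
  set S : ℕ → ℝ := fun n => b n ^ (-(1 / p)) * E.toReal with hS
  have hle : ∀ n, 1 ≤ n → ∀ y, smoothing k (b n) (endWeight β) y ≤
      ENNReal.ofReal (b n ^ (-(1 / p))) * E := fun n hn y =>
    smoothing_le hk hC (hb.pos n hn) hp1 (measurable_endWeight β) y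
  have htop : ∀ n, 1 ≤ n → ∀ y, smoothing k (b n) (endWeight β) y ≠ ∞ := fun n hn y =>
    ne_top_of_le_ne_top (ENNReal.mul_ne_top ENNReal.ofReal_ne_top hEt) (hle n hn y)
  have hφS : ∀ n, 1 ≤ n → ∀ y, φ n y ≤ S n := by
    intro n hn y
    have := ENNReal.toReal_mono (ENNReal.mul_ne_top ENNReal.ofReal_ne_top hEt) (hle n hn y)
    rwa [ENNReal.toReal_mul, ENNReal.toReal_ofReal (Real.rpow_nonneg (hb.pos n hn).le _)] at this
  have hSpos : ∀ n, 1 ≤ n → 0 < S n := fun n hn =>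
    mul_pos (Real.rpow_pos_of_pos (hb.pos n hn) _) (by linarith)
  have hmean : ∀ n, 1 ≤ n → ∀ i, ∫ ω, φ n (ξ i ω) / S n ∂P ≤ i₀ / S n := by
    intro n hn i
    rw [integral_div]
    refine div_le_div_of_nonneg_right ?_ (hSpos n hn).le
    rw [← integral_map (f := φ n) (hm i).aemeasurable (hφm n).aestronglyMeasurable, hu i,
      integral_toReal (measurable_smoothing hk (b n) (measurable_endWeight β)).aemeasurable
        (Eventually.of_forall fun y => (htop n hn y).lt_top)]
    refine le_trans (ENNReal.toReal_mono hI.ne ?_) (le_of_lt (lt_add_one _))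
    exact (setLIntegral_le_lintegral _ _).trans
      (lintegral_smoothing_le hk (b n) (measurable_endWeight β))
  set a : ℝ := 1 - 1 / p with ha
  have ha0 : 0 < a := by
    have : 1 / p < 1 := (div_lt_one hp0).2 hp1
    linarith
  have hbad : ∀ᶠ n : ℕ in atTop,
      P.real {ω | 3 * (n * (i₀ / S n)) ≤ ∑ i ∈ Finset.range n, φ n (ξ i ω) / S n} ≤
        (n : ℝ) * Real.exp (-(i₀ / E.toReal * (n : ℝ) ^ a)) := by
    filter_upwards [eventually_ge_atTop 1, hb.tendsto_mul.eventually_ge_atTop 1] with n hn hnb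
    have hn1 : (1 : ℝ) ≤ n := by exact_mod_cast hn
    have hn0 : (0 : ℝ) < n := by linarith
    have hbn := hb.pos n hn
    have h := measure_three_mul_le_sum (P := P) (X := fun i ω => φ n (ξ i ω) / S n)
      (fun i => ((hφm n).comp (hm i)).div_const _)
      (hind.comp (fun _ y => φ n y / S n) fun _ => (hφm n).div_const _)
      (fun i ω => ⟨div_nonneg ENNReal.toReal_nonneg (hSpos n hn).le,
        (div_le_one (hSpos n hn)).2 (hφS n hn _)⟩) (hmean n hn) n
    refine h.trans ?_
    -- From `n * b n ≥ 1`, `n * b n ^ (1 / p) ≥ n ^ (1 - 1 / p)`: the Chernoff exponent grows like a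
    -- positive power of `n`.
    have hcmp : i₀ / E.toReal * (n : ℝ) ^ a ≤ n * (i₀ / S n) := by
      have hSn : i₀ / S n = i₀ / E.toReal * b n ^ (1 / p) := by
        simp only [hS]
        rw [Real.rpow_neg hbn.le]
        field_simp
      have hpow : (n : ℝ) ^ (-(1 / p)) ≤ b n ^ (1 / p) := by
        rw [Real.rpow_neg hn0.le, ← Real.inv_rpow hn0.le]
        refine Real.rpow_le_rpow (by positivity) ?_ (by positivity)
        rw [inv_le_iff_one_le_mul₀ hn0]
        linarith
      have hsplit : (n : ℝ) ^ a = n * (n : ℝ) ^ (-(1 / p)) := by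
        nth_rewrite 2 [← Real.rpow_one (n : ℝ)]
        rw [← Real.rpow_add hn0, ha, sub_eq_add_neg]
      rw [hSn, hsplit, mul_left_comm]
      gcongr
    calc Real.exp (-(n * (i₀ / S n))) ≤ Real.exp (-(i₀ / E.toReal * (n : ℝ) ^ a)) :=
          Real.exp_le_exp.2 (by linarith)
      _ ≤ _ := le_mul_of_one_le_left (Real.exp_pos _).le hn1
  refine ⟨ENNReal.ofReal (3 * i₀), ENNReal.ofReal_ne_top, ?_⟩
  filter_upwards [ae_eventually_notMem_of_real_le
    (summable_nat_mul_exp_neg_rpow (by positivity) ha0) hbad] with ω hω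
  filter_upwards [hω, eventually_ge_atTop 1] with n hn hn1
  have hn0 : (0 : ℝ) < n := by exact_mod_cast hn1
  have hlt : (∑ i ∈ Finset.range n, φ n (ξ i ω)) / n ≤ 3 * i₀ := by
    have h1 := not_le.1 hn
    rw [← Finset.sum_div, div_lt_iff₀ (hSpos n hn1)] at h1
    have hne := (hSpos n hn1).ne'
    rw [div_le_iff₀ hn0]
    refine h1.le.trans (le_of_eq ?_)
    field_simp
  refine le_trans (le_of_eq ?_) (ENNReal.ofReal_le_ofReal hlt)
  rw [ENNReal.ofReal_div_of_pos hn0, ENNReal.ofReal_natCast, ENNReal.div_eq_inv_mul,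
    ENNReal.ofReal_sum_of_nonneg fun _ _ => ENNReal.toReal_nonneg]
  congr 1
  exact Finset.sum_congr rfl fun i _ => (ENNReal.ofReal_toReal (htop n hn1 _)).symm

/-! ### The two statistics -/

theorem kernelStat_eq_integral (k : ℝ → ℝ) {b : ℕ → ℝ} (g : ℝ → ℝ) (c : ℕ → ℕ → ℝ) (n : ℕ)
    (x : ℕ → ℝ)
    (hm : AEMeasurable (leftInverse (kernelEstimator k (b n) n x))
      (volume.restrict (Ioo (0 : ℝ) 1))) :
    kernelStat k b g c n x = ∫ u in Ioo (0 : ℝ) 1,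
      (Ioo (0 : ℝ) 1).indicator g (leftInverse (kernelEstimator k (b n) n x) u) *
        scoreFun c n u := by
  set Q := leftInverse (kernelEstimator k (b n) n x) with hQ
  have hns : NullMeasurableSet (Q ⁻¹' Ioo (0 : ℝ) 1) (volume.restrict (Ioo (0 : ℝ) 1)) :=
    hm.nullMeasurable measurableSet_Ioo
  have hset : {u | u ∈ Ioo (0 : ℝ) 1 ∧ Q u ∈ Ioo (0 : ℝ) 1} =
      Q ⁻¹' Ioo (0 : ℝ) 1 ∩ Ioo (0 : ℝ) 1 := by
    ext u; exact and_comm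
  unfold kernelStat
  rw [← hQ, hset, ← Measure.restrict_restrict₀ hns, ← integral_indicator₀ hns]
  refine integral_congr_ae (Eventually.of_forall fun u => ?_)
  by_cases hu : Q u ∈ Ioo (0 : ℝ) 1
  · simp only
    rw [indicator_of_mem (show u ∈ Q ⁻¹' Ioo (0 : ℝ) 1 from hu), indicator_of_mem hu]
  · simp only
    rw [indicator_of_notMem (show u ∉ Q ⁻¹' Ioo (0 : ℝ) 1 from hu), indicator_of_notMem hu,
      zero_mul]

end KernelLStat

end

open KernelLStat in
theorem corollary2 {Ω : Type*} [MeasurableSpace Ω] (P : Measure Ω) [IsProbabilityMeasure P]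
    (ξ : ℕ → Ω → ℝ) (hξ_meas : ∀ i, Measurable (ξ i)) (hξ_indep : iIndepFun ξ P)
    (hξ_unif : ∀ i, pdf.IsUniform (ξ i) (Ioo (0 : ℝ) 1) P)
    (k : ℝ → ℝ) (hk : KernelAssumption k)
    (b : ℕ → ℝ) (hb : BandwidthAssumption b)
    (g : ℝ → ℝ) (hg : MemG g) (c : ℕ → ℕ → ℝ)
    (J : ℝ → ℝ) (hJ : Measurable ((Ioo (0 : ℝ) 1).domRestrict J))
    (M b₁ b₂ δ : ℝ) (hM : 0 < M) (hb₁ : 0 < b₁) (hb₂ : 0 < b₂) (hδ : 0 < δ)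
    (hbound : BoundednessAssumption g hg c J M b₁ b₂ δ)
    (μinf : ℝ) (hμ : Tendsto (fun n => centering g c n) atTop (𝓝 μinf)) :
    (∀ᵐ ω ∂P, Tendsto (fun n => kernelStat k b g c n (fun i => ξ i ω)) atTop (𝓝 μinf)) ∧
    (∀ᵐ ω ∂P, Tendsto (fun n => orderStatSum g c n (fun i => ξ i ω)) atTop (𝓝 μinf)) := by
  have hu : ∀ i, P.map (ξ i) = volume.restrict (Ioo (0 : ℝ) 1) := fun i => by
    have h := hξ_unif i
    rw [pdf.IsUniform, ProbabilityTheory.cond] at h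
    simpa using h
  -- The cap `1 / 2` keeps `d < 1` when `δ` is large.
  set d : ℝ := min (δ / 2) (1 / 2) with hd
  have hd0 : 0 < d := lt_min (by linarith) (by norm_num)
  have hd1 : d < 1 := (min_le_right _ _).trans_lt (by norm_num)
  have hdδ : d ≤ δ / 2 := min_le_left _ _
  -- Chosen so that `(r - 1) * (b₁ + b₂) = δ / 2`, which serves both end points.
  set r : ℝ := 1 + δ / (2 * (b₁ + b₂)) with hr
  have hr1 : 1 < r := by
    have : 0 < δ / (2 * (b₁ + b₂)) := by positivity
    linarith
  have hr0 : 0 < r := by linarith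
  have hrb : ∀ s, 0 < s → s ≤ b₁ + b₂ → (r - 1) * s ≤ δ / 2 := by
    intro s hs hsb
    rw [hr, add_sub_cancel_left, div_mul_eq_mul_div, div_le_iff₀ (by positivity)]
    nlinarith
  have hr₁ := hrb b₁ hb₁ (by linarith)
  have hr₂ := hrb b₂ hb₂ (by linarith)
  have hβ0 : 0 ≤ (1 - d) * (1 + d) := mul_nonneg (by linarith) (by linarith)
  have hβ1 : (1 - d) * (1 + d) < 1 := by nlinarith
  have hsample := ae_uniformSample hξ_meas hξ_indep hu hr1
  constructor
  · obtain ⟨A, hA, hmom⟩ :=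
      ae_eventually_smoothing_average_le hξ_meas hξ_indep hu hk hb hβ0 hβ1
    filter_upwards [hsample, hmom] with ω h1 h2
    have hQ := h1.quantileApprox_kernel hk hb hA h2
    refine (hQ.tendsto_integral hr0 hd0 hd1 hg hM hb₁ hb₂ hdδ hr₁ hr₂ hbound hμ).congr' ?_
    filter_upwards [eventually_ge_atTop 1] with n hn
    exact (kernelStat_eq_integral k g c n _ (hQ.aemeasurable_quantile hn)).symm
  · have hw : IntegrableOn (fun t => (endWeight ((1 - d) * (1 + d)) t).toReal) (Ioo (0 : ℝ) 1) :=
      (integrable_toReal_of_lintegral_ne_top (measurable_endWeight _).aemeasurable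
        (lintegral_endWeight_lt_top hβ0 hβ1).ne).integrableOn
    filter_upwards [hsample, ae_tendsto_average hξ_meas hξ_indep hu
      (measurable_endWeight _).ennreal_toReal hw] with ω h1 h2
    refine ((h1.quantileApprox_order h2).tendsto_integral hr0 hd0 hd1 hg hM hb₁ hb₂ hdδ hr₁ hr₂
      hbound hμ).congr' ?_
    filter_upwards [eventually_ge_atTop 1] with n hn
    exact (orderStatSum_eq_integral g c h1.mem hn).symm
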